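/- Let $m$ be Lebesgue measure on $Y=\mathbb R$. An automorphism of $Y$ is a bimeasurable bijection $T:Y\to Y$ preserving $m$; we also write $T$ for the unitary operator $f\mapsto f\circ T$ on $L_2(Y,m)$, and similarly for other measure-preserving transformations. Say that $T$ satisfies $(*)$ if for some $a$ with $0<a<1$ and some sequences of natural numbers $m_i\to\infty$, $n_j\to\infty$ one has $$T^{m_i}\to aI \ \text{ in the weak operator topology},\qquad T^{n_j}\to I\ \text{ in the strong operator topology on } L_2(Y,m).$$ For an integer $p>1$ let $\mu=m\times\nu$, where $\nu$ is the uniform probability measure on $\mathbb Z_p=\mathbb Z/p\mathbb Z$, and let $F_p=F(T,p)$ be the $\mu$-preserving transformation of $Y\times\mathbb Z_p$ given by $F_p(x,z)=(Tx,z+1)$ if $z=0$ and $F_p(x,z)=(x,z+1)$ if $z\ne 0$. A measure-preserving automorphism $S$ of a $\sigma$-finite space $(X,\mu)$ with $L_2(X,\mu)$ separable has property $(\perp)$ if its spectral measure $\sigma$ (a finite Borel measure on the unit circle of maximal spectral type for the operator $S$ on $L_2(X,\mu)$) is mutually singular with each of its convolution powers $\sigma^{*n}$, $n>1$; equivalently,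 if for every $n>1$ the only bounded operator $J: L_2(X,\mu)^{\otimes n}\to L_2(X,\mu)$ with $SJ=JS^{\otimes n}$ is $J=0$. **Lemma 2.** (i) There is an ergodic automorphism $T$ of $Y$ satisfying $(*)$. (ii) If an automorphism $T$ of $Y$ satisfies $(*)$, then for every integer $p>1$ the automorphism $F_p=F(T,p)$ has property $(\perp)$, in both of the above formulations. -/

import Mathlib

open MeasureTheory Filter Topology
open scoped InnerProductSpace ENNReal

noncomputable section

/-! ### Koopman operators and limits of powers -/

/-- The Koopman operator `f ↦ f ∘ T` on the complex Hilbert space `L²(μ)`. -/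
def koopman {X : Type*} [MeasurableSpace X] {μ : Measure X} {T : X → X}
    (hT : MeasurePreserving T μ μ) : Lp ℂ 2 μ →L[ℂ] Lp ℂ 2 μ :=
  (Lp.compMeasurePreservingₗᵢ ℂ T hT).toContinuousLinearMap

/-- Along `m i → ∞` the powers `U ^ m i` converge to `c • I` in the weak operator topology. -/
def WeakPowerLimit {H : Type*} [NormedAddCommGroup H] [InnerProductSpace ℂ H]
    (U : H →L[ℂ] H) (m : ℕ → ℕ) (c : ℝ) : Prop :=
  ∀ f g : H, Tendsto (fun i => ⟪g, (U ^ m i) f⟫_ℂ) atTop (𝓝 ((c : ℂ) * ⟪g, f⟫_ℂ))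

/-- Along `n j → ∞` the powers `U ^ n j` converge to `I` in the strong operator topology. -/
def StrongPowerLimitOne {H : Type*} [NormedAddCommGroup H] [InnerProductSpace ℂ H]
    (U : H →L[ℂ] H) (n : ℕ → ℕ) : Prop :=
  ∀ f : H, Tendsto (fun j => (U ^ n j) f) atTop (𝓝 f)

/-- For some `0 < a < 1` and some sequences `m i, n j → ∞` one has
`T ^ m i → a I` weakly and `T ^ n j → I` strongly on `L²`. -/
def HasMixedLimits {X : Type*} [MeasurableSpace X] {μ : Measure X} {T : X → X}
    (hT : MeasurePreserving T μ μ) : Prop :=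
  ∃ (a : ℝ) (m n : ℕ → ℕ), 0 < a ∧ a < 1 ∧ Tendsto m atTop atTop ∧ Tendsto n atTop atTop ∧
    WeakPowerLimit (koopman hT) m a ∧ StrongPowerLimitOne (koopman hT) n

/-! ### Spectral measures, the maximal spectral type, and its convolution powers -/

/-- The Borel σ-algebra of the unit circle. -/
instance circleMeasurableSpace : MeasurableSpace Circle := borel Circle

instance circleBorelSpace : BorelSpace Circle := ⟨rfl⟩

/-- `σ` is the spectral measure of the vector `f` for the unitary operator `U`: the finite Borel
measure on the circle with `∫ zⁿ dσ = ⟪f, Uⁿ f⟫` (the coefficients with `n < 0` are the complex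
conjugates of those with `n > 0`). -/
def IsSpectralMeasureOf {H : Type*} [NormedAddCommGroup H] [InnerProductSpace ℂ H]
    (U : H →L[ℂ] H) (f : H) (σ : Measure Circle) : Prop :=
  IsFiniteMeasure σ ∧ ∀ n : ℕ, ∫ z : Circle, (z : ℂ) ^ n ∂σ = ⟪f, (U ^ n) f⟫_ℂ

/-- `σ` is a measure of maximal spectral type for `U`: it is a finite measure equivalent to the
spectral measure of some vector, and it dominates the spectral measure of every vector. -/
def IsMaximalSpectralMeasure {H : Type*} [NormedAddCommGroup H] [InnerProductSpace ℂ H]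
    (U : H →L[ℂ] H) (σ : Measure Circle) : Prop :=
  IsFiniteMeasure σ ∧
    (∃ (f : H) (ρ : Measure Circle), IsSpectralMeasureOf U f ρ ∧ ρ ≪ σ ∧ σ ≪ ρ) ∧
    ∀ (f : H) (ρ : Measure Circle), IsSpectralMeasureOf U f ρ → ρ ≪ σ

/-- The convolution power `σ^{*n}` of a measure on the circle, with `σ^{*0}` the unit mass at `1`. -/
def convPower (σ : Measure Circle) : ℕ → Measure Circle
  | 0 => Measure.dirac 1
  | n + 1 => Measure.mconv (convPower σ n) σ

/-- The spectral measure (a measure of maximal spectral type) of the automorphism is mutually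
singular with its convolution powers. -/
def SpectrumSingularToPowers {X : Type*} [MeasurableSpace X] {μ : Measure X} {T : X → X}
    (hT : MeasurePreserving T μ μ) : Prop :=
  ∃ σ : Measure Circle, IsMaximalSpectralMeasure (koopman hT) σ ∧
    ∀ n : ℕ, 1 < n → Measure.MutuallySingular σ (convPower σ n)

/-! ### Intertwining with tensor powers -/

/-- The tensor power `T^{⊗n}`: the Koopman operator of `T × ⋯ × T` on
`L²(μ × ⋯ × μ) = L²(μ)^{⊗n}`. -/
def tensorPower {X : Type*} [MeasurableSpace X] {μ : Measure X} [SigmaFinite μ] {T : X → X}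
    (hT : MeasurePreserving T μ μ) (n : ℕ) :
    Lp ℂ 2 (Measure.pi fun _ : Fin n => μ) →L[ℂ] Lp ℂ 2 (Measure.pi fun _ : Fin n => μ) :=
  koopman (measurePreserving_pi (fun _ : Fin n => μ) (fun _ : Fin n => μ) (fun _ => hT))

/-- No nonzero bounded operator `J` intertwines `T` with one of its tensor powers `T^{⊗n}`,
`n > 1`. -/
def NoIntertwiningWithPowers {X : Type*} [MeasurableSpace X] {μ : Measure X} [SigmaFinite μ]
    {T : X → X} (hT : MeasurePreserving T μ μ) : Prop :=
  ∀ n : ℕ, 1 < n → ∀ J : Lp ℂ 2 (Measure.pi fun _ : Fin n => μ) →L[ℂ] Lp ℂ 2 μ,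
    koopman hT ∘L J = J ∘L tensorPower hT n → J = 0

/-! ### The extension `F(T, p)` -/

/-- The map `F(T, p)` of `ℝ × ℤ_p`: `(x, z) ↦ (T x, z + 1)` if `z = 0`, and
`(x, z) ↦ (x, z + 1)` otherwise. -/
def cyclicExtension (T : ℝ → ℝ) (p : ℕ) : ℝ × ZMod p → ℝ × ZMod p :=
  fun q => (if q.2 = 0 then T q.1 else q.1, q.2 + 1)

/-- Lebesgue measure on `ℝ` times the uniform probability measure on `ℤ_p`. -/
def extMeasure (p : ℕ) : Measure (ℝ × ZMod p) :=
  (volume : Measure ℝ).prod (ProbabilityTheory.uniformOn (Set.univ : Set (ZMod p)))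

instance extMeasure_sigmaFinite (p : ℕ) : SigmaFinite (extMeasure p) := by
  unfold extMeasure; infer_instance

theorem uniformOn_add_one (p : ℕ) (hp : 1 < p) :
    MeasurePreserving (fun z : ZMod p => z + 1)
      (ProbabilityTheory.uniformOn Set.univ) (ProbabilityTheory.uniformOn Set.univ) := by
  have : NeZero p := ⟨by omega⟩
  refine ⟨measurable_from_top, ?_⟩
  ext s hs
  rw [Measure.map_apply measurable_from_top hs, ProbabilityTheory.uniformOn_univ,
    ProbabilityTheory.uniformOn_univ]
  congr 1
  have h := (measurePreserving_add_right (Measure.count : Measure (ZMod p)) 1).measure_preimage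
    hs.nullMeasurableSet
  exact h

theorem cyclicExtension_measurePreserving {T : ℝ → ℝ} (hT : MeasurePreserving T volume volume)
    (p : ℕ) (hp : 1 < p) :
    MeasurePreserving (cyclicExtension T p) (extMeasure p) (extMeasure p) := by
  have hg : Measurable (Function.uncurry fun (z : ZMod p) (x : ℝ) => if z = 0 then T x else x) :=
    Measurable.ite (measurable_fst (measurableSet_singleton (0 : ZMod p)))
      (hT.measurable.comp measurable_snd) measurable_snd
  have h := (uniformOn_add_one p hp).skew_product (μc := (volume : Measure ℝ))
    (μd := (volume : Measure ℝ)) hg (Eventually.of_forall fun z => by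
      by_cases hz : z = 0
      · simpa [hz] using hT.map_eq
      · simp [hz])
  exact (Measure.measurePreserving_swap.comp h).comp Measure.measurePreserving_swap

end

/-! Everything rests on one remark: if powers of $S$ along $k_i$ converge weakly to $aI$ with
$0<a<1$, the same powers of $S^{\otimes n}$ converge to $a^nI$, and $a^n\ne a$ for $n>1$. An
intertwiner $J$ then satisfies $aJ=a^nJ$, so $J=0$. On the spectral side, $z^{k_i}$ tends weakly to
the constant $a$ over $\sigma$ and to $a^n$ over $\sigma^{*n}$. This persists for absolutely
continuous parts (`MonomialLimit.integral_mul`), so no nonzero part of one measure can be absolutely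
continuous with respect to the other (`MonomialLimit.mutuallySingular`). The limit is available for
$F_p$ because $F_p^{\,p}=T\times\mathrm{Id}$, hence $F_p^{\,pm_i}\to aI$.

A maximal spectral measure comes from the continuous functional calculus and Riesz–Markov, then from
a weighted sum over a maximal family of unit vectors with orthogonal cyclic subspaces.

The example is a rank-one map. The tower of height $h_j$ is cut into $r_j$ columns, which are
stacked with $h_j$ spacers below and $h_j$ above. The power $h_j$ moves each column onto the next
and the last one into the spacers, so a level keeps the share $1-1/r_j$ of itself
(`measureReal_shift_preimage`). With $r_j=2$ at even stages and $r_j\to\infty$ at odd ones, the weak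
limits are $I/2$ and $I$; for isometries, a weak limit $I$ is strong. The spacers on both sides make
the towers exhaust the line and make the map defined and invertible at every point. -/

noncomputable section

/-! ### Generating π-systems and weak limits of powers -/

/-- A locally integrable function whose integrals over a generating π-system vanish is zero. -/
theorem ae_eq_zero_of_setIntegral_piSystem {X : Type*} [mX : MeasurableSpace X] {μ : Measure X}
    {C : Set (Set X)} (hgen : mX = MeasurableSpace.generateFrom C) (hpi : IsPiSystem C)
    (S : ℕ → Set X) (hS : ∀ n, S n ∈ C) (hcov : ⋃ n, S n = Set.univ)
    {h : X → ℂ} (hint : ∀ A ∈ C, IntegrableOn h A μ) (hzero : ∀ A ∈ C, ∫ x in A, h x ∂μ = 0) :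
    h =ᵐ[μ] 0 := by
  have hm : ∀ A ∈ C, MeasurableSet A := fun A hA => hgen ▸ .basic A hA
  -- Restricting to `S n` makes `h` integrable, so the sets with zero integral form a Dynkin system.
  have key : ∀ n, ∀ A, MeasurableSet A → ∫ x in A, h x ∂(μ.restrict (S n)) = 0 := by
    intro n A hA
    have hi : Integrable h (μ.restrict (S n)) := hint _ (hS n)
    have htot : ∫ x, h x ∂(μ.restrict (S n)) = 0 := hzero _ (hS n)
    induction A, hA using MeasurableSpace.induction_on_inter hgen hpi with
    | empty => simp
    | basic t ht =>
      rw [Measure.restrict_restrict (hm t ht)]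
      rcases (t ∩ S n).eq_empty_or_nonempty with he | hne
      · simp [he]
      · exact hzero _ (hpi t ht _ (hS n) hne)
    | compl t ht ih =>
      have := integral_add_compl ht hi
      rw [ih, htot, zero_add] at this
      exact this
    | iUnion f hd hf ih =>
      rw [integral_iUnion hf hd hi.integrableOn]
      simp [ih]
  have hS0 : ∀ n, h =ᵐ[μ.restrict (S n)] 0 := fun n =>
    Integrable.ae_eq_zero_of_forall_setIntegral_eq_zero (hint _ (hS n)) fun s hs _ => key n s hs
  have := (ae_restrict_iUnion_iff S (fun x => h x = 0) (μ := μ)).2 hS0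
  rwa [hcov, Measure.restrict_univ] at this

/-- A uniform bound passes convergence from a total set to its closed span. Homogeneity is asked
only in norm, so that both slots of the inner product qualify, the conjugate-linear one included. -/
theorem tendsto_zero_of_dense_span {H : Type*} [NormedAddCommGroup H] [NormedSpace ℂ H]
    (φ : ℕ → H → ℂ) (hadd : ∀ i f g, φ i (f + g) = φ i f + φ i g)
    (hsmul : ∀ i (c : ℂ) f, ‖φ i (c • f)‖ = ‖c‖ * ‖φ i f‖) (M : ℝ)
    (hb : ∀ i f, ‖φ i f‖ ≤ M * ‖f‖) (s : Set H)
    (hs : (Submodule.span ℂ s).topologicalClosure = ⊤)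
    (h : ∀ f ∈ s, Tendsto (fun i => φ i f) atTop (𝓝 0)) (f : H) :
    Tendsto (fun i => φ i f) atTop (𝓝 0) := by
  have hspan : ∀ g ∈ Submodule.span ℂ s, Tendsto (fun i => φ i g) atTop (𝓝 0) := by
    intro g hg
    induction hg using Submodule.span_induction with
    | mem x hx => exact h x hx
    | zero =>
      have : ∀ i, φ i 0 = 0 := fun i => by simpa using hb i 0
      simp [this]
    | add x y _ _ hx hy => simpa [hadd] using hx.add hy
    | smul a x _ hx =>
      rw [tendsto_zero_iff_norm_tendsto_zero] at hx ⊢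
      simpa [hsmul] using hx.const_mul ‖a‖
  have hf : f ∈ closure (Submodule.span ℂ s : Set H) := by
    rw [← Submodule.topologicalClosure_coe, hs]; trivial
  rw [Metric.tendsto_atTop]
  intro ε hε
  have hM : 0 < |M| + 1 := by positivity
  obtain ⟨g, hg, hfg⟩ := Metric.mem_closure_iff.1 hf (ε / 2 / (|M| + 1)) (by positivity)
  obtain ⟨N, hN⟩ := Metric.tendsto_atTop.1 (hspan g hg) (ε / 2) (by positivity)
  refine ⟨N, fun i hi => ?_⟩
  have h1 := hN i hi
  rw [dist_zero_right] at h1 ⊢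
  have h2 : φ i f = φ i (f - g) + φ i g := by rw [← hadd, sub_add_cancel]
  have h3 : ‖φ i (f - g)‖ ≤ (|M| + 1) * ‖f - g‖ :=
    (hb i _).trans (mul_le_mul_of_nonneg_right (by linarith [le_abs_self M]) (norm_nonneg _))
  rw [dist_eq_norm, lt_div_iff₀ hM] at hfg
  calc ‖φ i f‖ ≤ ‖φ i (f - g)‖ + ‖φ i g‖ := by rw [h2]; exact norm_add_le _ _
    _ < ε := by linarith [mul_comm (|M| + 1) ‖f - g‖]

theorem norm_pow_apply {H : Type*} [NormedAddCommGroup H] [InnerProductSpace ℂ H]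
    {U : H →L[ℂ] H} (hU : ∀ f, ‖U f‖ = ‖f‖) (n : ℕ) (f : H) : ‖(U ^ n) f‖ = ‖f‖ := by
  induction n generalizing f with
  | zero => simp
  | succ n ih => rw [pow_succ, mul_apply_eq_comp, ih, hU]

/-- Weak convergence of powers of an isometry may be tested on a total set. -/
theorem weakPowerLimit_of_dense {H : Type*} [NormedAddCommGroup H] [InnerProductSpace ℂ H]
    {U : H →L[ℂ] H} (hU : ∀ f, ‖U f‖ = ‖f‖) {m : ℕ → ℕ} {c : ℝ} {s : Set H}
    (hs : (Submodule.span ℂ s).topologicalClosure = ⊤)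
    (h : ∀ f ∈ s, ∀ g ∈ s,
      Tendsto (fun i => ⟪g, (U ^ m i) f⟫_ℂ) atTop (𝓝 ((c : ℂ) * ⟪g, f⟫_ℂ))) :
    WeakPowerLimit U m c := by
  set W : ℕ → H → H := fun i f => (U ^ m i) f - (c : ℂ) • f
  have hW : ∀ i f, ‖W i f‖ ≤ (1 + |c|) * ‖f‖ := fun i f => by
    refine (norm_sub_le _ _).trans ?_
    rw [norm_pow_apply hU, norm_smul, Complex.norm_real, Real.norm_eq_abs]
    linarith
  have hW' : ∀ i f g, ⟪g, W i f⟫_ℂ = ⟪g, (U ^ m i) f⟫_ℂ - (c : ℂ) * ⟪g, f⟫_ℂ := fun i f g => by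
    simp [W]
  have hiff : ∀ f g, Tendsto (fun i => ⟪g, (U ^ m i) f⟫_ℂ) atTop (𝓝 ((c : ℂ) * ⟪g, f⟫_ℂ)) ↔
      Tendsto (fun i => ⟪g, W i f⟫_ℂ) atTop (𝓝 0) := fun f g => by
    simp_rw [hW']; exact tendsto_sub_nhds_zero_iff.symm
  -- The density argument runs twice: first in `g` with `f` in the total set, then in `f`.
  have h1 : ∀ f ∈ s, ∀ g, Tendsto (fun i => ⟪g, W i f⟫_ℂ) atTop (𝓝 0) := by
    intro f hf
    refine tendsto_zero_of_dense_span (fun i g => ⟪g, W i f⟫_ℂ) (fun i g g' => inner_add_left _ _ _)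
      (fun i a g => by simp [mul_comm]) ((1 + |c|) * ‖f‖) (fun i g => ?_) s hs
      fun g hg => (hiff f g).1 (h f hf g hg)
    refine (norm_inner_le_norm _ _).trans ?_
    rw [mul_comm]
    exact mul_le_mul_of_nonneg_right (hW i f) (norm_nonneg _)
  intro f g
  rw [hiff]
  refine tendsto_zero_of_dense_span (fun i f => ⟪g, W i f⟫_ℂ) (fun i f f' => ?_)
      (fun i a f => ?_) ((1 + |c|) * ‖g‖) (fun i f => ?_) s hs (fun f hf => h1 f hf g) f
  · rw [← inner_add_right]; congr 1; simp only [W, map_add, smul_add]; abel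
  · have : W i (a • f) = a • W i f := by
      simp only [W, map_smul, smul_sub, smul_comm a]
    rw [this, inner_smul_right, norm_mul]
  · refine (norm_inner_le_norm _ _).trans ?_
    have := mul_le_mul_of_nonneg_left (hW i f) (norm_nonneg g)
    linarith

/-- The indicators of the members of a generating π-system of sets of finite measure are total
in `L²`. -/
theorem dense_span_indicator {X : Type*} [mX : MeasurableSpace X] {μ : Measure X}
    {C : Set (Set X)} (hgen : mX = MeasurableSpace.generateFrom C) (hpi : IsPiSystem C)
    (S : ℕ → Set X) (hS : ∀ n, S n ∈ C) (hcov : ⋃ n, S n = Set.univ)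
    (hfin : ∀ A ∈ C, μ A ≠ ∞) :
    (Submodule.span ℂ {f : Lp ℂ 2 μ | ∃ A ∈ C, ∃ (hA : MeasurableSet A) (hμ : μ A ≠ ∞),
      f = indicatorConstLp 2 hA hμ 1}).topologicalClosure = ⊤ := by
  rw [Submodule.topologicalClosure_eq_top_iff, Submodule.eq_bot_iff]
  intro h hh
  rw [Submodule.mem_orthogonal] at hh
  rw [Lp.eq_zero_iff_ae_eq_zero]
  refine ae_eq_zero_of_setIntegral_piSystem hgen hpi S hS hcov (fun A hA => ?_) fun A hA => ?_
  · exact integrableOn_Lp_of_measure_ne_top h (by norm_num) (hfin A hA)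
  · have hm : MeasurableSet A := hgen ▸ .basic A hA
    rw [← L2.inner_indicatorConstLp_one hm (hfin A hA)]
    exact hh _ (Submodule.subset_span ⟨A, hA, hm, hfin A hA, rfl⟩)

theorem koopman_norm {X : Type*} [MeasurableSpace X] {μ : Measure X} {T : X → X}
    (hT : MeasurePreserving T μ μ) (f : Lp ℂ 2 μ) : ‖koopman hT f‖ = ‖f‖ :=
  Lp.norm_compMeasurePreserving f hT

theorem koopman_pow_apply {X : Type*} [MeasurableSpace X] {μ : Measure X} {T : X → X}
    (hT : MeasurePreserving T μ μ) (n : ℕ) (f : Lp ℂ 2 μ) :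
    (koopman hT ^ n) f = Lp.compMeasurePreserving T^[n] (hT.iterate n) f := by
  rw [← Lp.compMeasurePreserving_iterate, FunLike.coe_pow_eq_iterate]
  rfl

theorem inner_indicator_koopman_pow {X : Type*} [MeasurableSpace X] {μ : Measure X} {T : X → X}
    (hT : MeasurePreserving T μ μ) (n : ℕ) {A B : Set X} (hA : MeasurableSet A)
    (hB : MeasurableSet B) (hμA : μ A ≠ ∞) (hμB : μ B ≠ ∞) :
    ⟪indicatorConstLp 2 hA hμA (1 : ℂ), (koopman hT ^ n) (indicatorConstLp 2 hB hμB 1)⟫_ℂ =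
      μ.real (A ∩ T^[n] ⁻¹' B) := by
  rw [koopman_pow_apply, Lp.indicatorConstLp_compMeasurePreserving]
  exact L2.inner_indicatorConstLp_one_indicatorConstLp_one hA
    (hB.preimage (hT.iterate n).measurable) hμA _

/-- Weak convergence of Koopman powers may be tested on a generating π-system. -/
theorem weakPowerLimit_of_piSystem {X : Type*} [mX : MeasurableSpace X] {μ : Measure X} {T : X → X}
    (hT : MeasurePreserving T μ μ)
    {C : Set (Set X)} (hgen : mX = MeasurableSpace.generateFrom C) (hpi : IsPiSystem C)
    (S : ℕ → Set X) (hS : ∀ n, S n ∈ C) (hcov : ⋃ n, S n = Set.univ)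
    (hfin : ∀ A ∈ C, μ A ≠ ∞) {m : ℕ → ℕ} {c : ℝ}
    (h : ∀ A ∈ C, ∀ B ∈ C,
      Tendsto (fun i => μ.real (A ∩ T^[m i] ⁻¹' B)) atTop (𝓝 (c * μ.real (A ∩ B)))) :
    WeakPowerLimit (koopman hT) m c := by
  refine weakPowerLimit_of_dense (koopman_norm hT)
    (dense_span_indicator hgen hpi S hS hcov hfin) ?_
  rintro _ ⟨B, hBC, hB, hμB, rfl⟩ _ ⟨A, hAC, hA, hμA, rfl⟩
  simp_rw [inner_indicator_koopman_pow]
  rw [L2.inner_indicatorConstLp_one_indicatorConstLp_one]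
  have := (Complex.continuous_ofReal.tendsto _).comp (h A hAC B hBC)
  rwa [Complex.ofReal_mul] at this

theorem WeakPowerLimit.tendsto_measure {X : Type*} [MeasurableSpace X] {μ : Measure X} {T : X → X}
    {hT : MeasurePreserving T μ μ} {m : ℕ → ℕ} {c : ℝ} (h : WeakPowerLimit (koopman hT) m c)
    {A B : Set X} (hA : MeasurableSet A) (hB : MeasurableSet B) (hμA : μ A ≠ ∞) (hμB : μ B ≠ ∞) :
    Tendsto (fun i => μ.real (A ∩ T^[m i] ⁻¹' B)) atTop (𝓝 (c * μ.real (A ∩ B))) := by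
  have := h (indicatorConstLp 2 hB hμB 1) (indicatorConstLp 2 hA hμA 1)
  simp_rw [inner_indicator_koopman_pow] at this
  rw [L2.inner_indicatorConstLp_one_indicatorConstLp_one] at this
  have := (Complex.continuous_re.tendsto _).comp this
  simpa [Function.comp_def] using this

/-- An isometry whose powers converge weakly to the identity converges strongly. -/
theorem WeakPowerLimit.strongPowerLimitOne {H : Type*} [NormedAddCommGroup H]
    [InnerProductSpace ℂ H] {U : H →L[ℂ] H} (hU : ∀ f, ‖U f‖ = ‖f‖) {n : ℕ → ℕ}
    (h : WeakPowerLimit U n 1) : StrongPowerLimitOne U n := by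
  intro f
  rw [tendsto_iff_norm_sub_tendsto_zero]
  have h1 : ∀ j, ‖(U ^ n j) f - f‖ ^ 2 = 2 * ‖f‖ ^ 2 - 2 * (⟪f, (U ^ n j) f⟫_ℂ).re := fun j => by
    rw [norm_sub_rev, @norm_sub_sq ℂ, norm_pow_apply hU, RCLike.re_eq_complex_re]
    ring
  have h2 : Tendsto (fun j => ‖(U ^ n j) f - f‖ ^ 2) atTop (𝓝 0) := by
    simp_rw [h1]
    have h3 := (Complex.continuous_re.tendsto _).comp (h f f)
    have h4 := (h3.const_mul 2).const_sub (2 * ‖f‖ ^ 2)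
    have h5 : (⟪f, f⟫_ℂ).re = ‖f‖ ^ 2 := by
      rw [inner_self_eq_norm_sq_to_K]; norm_cast
    simp only [Complex.ofReal_one, one_mul, h5, sub_self] at h4
    exact h4
  simpa using h2.sqrt

/-! ### Weak limits for products -/

/-- Sets of finite measure serve as sides of the boxes on which weak convergence in products is
tested; they generate by σ-finiteness. -/
theorem finiteMeasureSets_generating {X : Type*} [mX : MeasurableSpace X] (μ : Measure X)
    [SigmaFinite μ] :
    MeasurableSpace.generateFrom {A : Set X | MeasurableSet A ∧ μ A ≠ ∞} = mX := by
  refine le_antisymm (MeasurableSpace.generateFrom_le fun A hA => hA.1) fun A hA => ?_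
  have : A = ⋃ n, A ∩ spanningSets μ n := by
    rw [← Set.inter_iUnion, iUnion_spanningSets, Set.inter_univ]
  rw [this]
  refine MeasurableSet.iUnion fun n => MeasurableSpace.measurableSet_generateFrom
    ⟨hA.inter (measurableSet_spanningSets μ n), ?_⟩
  exact ((measure_mono Set.inter_subset_right).trans_lt (measure_spanningSets_lt_top μ n)).ne

theorem finiteMeasureSets_isPiSystem {X : Type*} [MeasurableSpace X] (μ : Measure X) :
    IsPiSystem {A : Set X | MeasurableSet A ∧ μ A ≠ ∞} := fun _ hA _ hB _ =>
  ⟨hA.1.inter hB.1, ((measure_mono Set.inter_subset_left).trans_lt hA.2.lt_top).ne⟩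

theorem finiteMeasureSets_isCountablySpanning {X : Type*} [MeasurableSpace X] (μ : Measure X)
    [SigmaFinite μ] : IsCountablySpanning {A : Set X | MeasurableSet A ∧ μ A ≠ ∞} :=
  ⟨spanningSets μ, fun n => ⟨measurableSet_spanningSets μ n, (measure_spanningSets_lt_top μ n).ne⟩,
    iUnion_spanningSets μ⟩

/-- If `T ^ m i → c I` weakly, then `(T^{⊗n}) ^ m i → c ^ n I` weakly. -/
theorem WeakPowerLimit.tensorPower {X : Type*} [MeasurableSpace X] {μ : Measure X} [SigmaFinite μ]
    {T : X → X} {hT : MeasurePreserving T μ μ} {m : ℕ → ℕ} {c : ℝ}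
    (h : WeakPowerLimit (koopman hT) m c) (n : ℕ) :
    WeakPowerLimit (tensorPower hT n) m (c ^ n) := by
  obtain ⟨S, hS, hcov⟩ := IsCountablySpanning.pi
    (fun _ : Fin n => finiteMeasureSets_isCountablySpanning μ)
  refine weakPowerLimit_of_piSystem _
    (generateFrom_eq_pi (fun _ : Fin n => finiteMeasureSets_generating μ)
      (fun _ => finiteMeasureSets_isCountablySpanning μ)).symm
    (IsPiSystem.pi fun _ => finiteMeasureSets_isPiSystem μ) S hS hcov ?_ ?_
  · rintro _ ⟨A, hA, rfl⟩
    rw [Measure.pi_pi]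
    exact ENNReal.prod_ne_top fun i _ => (hA i trivial).2
  · rintro _ ⟨A, hA, rfl⟩ _ ⟨B, hB, rfl⟩
    have hit : ∀ k : ℕ, (fun (x : Fin n → X) i => T (x i))^[k] = fun x i => T^[k] (x i) := by
      intro k
      induction k with
      | zero => rfl
      | succ k ih => funext x; simp [Function.iterate_succ, ih]
    have hset : ∀ k : ℕ, (Set.univ.pi A) ∩ (fun (x : Fin n → X) i => T (x i))^[k] ⁻¹'
        (Set.univ.pi B) = Set.univ.pi fun i => A i ∩ T^[k] ⁻¹' B i := by
      intro k
      rw [hit]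
      ext x
      simp [Set.mem_pi, forall_and]
    -- Measures of boxes factor, so each coordinate contributes one factor `c` in the limit.
    simp_rw [hset, ← Set.pi_inter_distrib, Measure.real, Measure.pi_pi, ENNReal.toReal_prod]
    have := tendsto_finsetProd (f := fun i (k : ℕ) => (μ (A i ∩ T^[m k] ⁻¹' B i)).toReal)
      Finset.univ (fun i _ => h.tendsto_measure (hA i trivial).1 (hB i trivial).1
        (hA i trivial).2 (hB i trivial).2)
    simpa [Finset.prod_mul_distrib, Measure.real] using this

/-- A weak limit `a I` of powers with `0 < a < 1` excludes intertwining with tensor powers. -/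
theorem noIntertwiningWithPowers_of_weakPowerLimit {X : Type*} [MeasurableSpace X] {μ : Measure X}
    [SigmaFinite μ] {T : X → X} {hT : MeasurePreserving T μ μ} {m : ℕ → ℕ} {a : ℝ}
    (ha : 0 < a) (ha' : a < 1) (h : WeakPowerLimit (koopman hT) m a) :
    NoIntertwiningWithPowers hT := by
  intro n hn J hJ
  have hpow : ∀ k : ℕ, ∀ f, (koopman hT ^ k) (J f) = J ((tensorPower hT n ^ k) f) := by
    intro k
    induction k with
    | zero => simp
    | succ k ih =>
      intro f
      rw [pow_succ, pow_succ, mul_apply_eq_comp, mul_apply_eq_comp, ← ih]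
      congr 1
      exact congrArg (fun V => V f) hJ
  ext1 f
  refine ext_inner_left ℂ fun g => ?_
  have h1 := h (J f) g
  -- With `J` moved to the other side as its adjoint, the same sequence has the limits `a * ⟪g, J
  -- f⟫` and `a ^ n * ⟪g, J f⟫`.
  have h2 := h.tensorPower n f (ContinuousLinearMap.adjoint J g)
  simp_rw [ContinuousLinearMap.adjoint_inner_left, ← hpow] at h2
  have h3 := tendsto_nhds_unique h1 h2
  have hne : (a : ℂ) - ((a ^ n : ℝ) : ℂ) ≠ 0 := by
    rw [← Complex.ofReal_sub]
    exact_mod_cast (sub_pos.2 (pow_lt_self_of_lt_one₀ ha ha' hn)).ne'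
  have h4 : ((a : ℂ) - ((a ^ n : ℝ) : ℂ)) * ⟪g, J f⟫_ℂ = 0 := by rw [sub_mul, h3, sub_self]
  simpa using (mul_eq_zero.1 h4).resolve_left hne

/-! ### Powers of the cyclic extension -/

/-- Away from floor `0` only the second coordinate moves. The case `v + k = p` is allowed: floor `0`
has just been reached and `T` has not yet acted. -/
theorem cyclicExtension_iterate_of_pos (T : ℝ → ℝ) (p : ℕ) (x : ℝ) (v k : ℕ) (hv : 0 < v)
    (hvk : v + k ≤ p) :
    (cyclicExtension T p)^[k] (x, (v : ZMod p)) = (x, ((v + k : ℕ) : ZMod p)) := by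
  induction k with
  | zero => simp
  | succ k ih =>
    rw [Function.iterate_succ_apply', ih (by omega)]
    have : ((v + k : ℕ) : ZMod p) ≠ 0 := by
      rw [Ne, ZMod.natCast_eq_zero_iff]
      exact fun h => absurd (Nat.le_of_dvd (by omega) h) (by omega)
    unfold cyclicExtension
    rw [if_neg this]
    push_cast
    rw [add_assoc]

theorem cyclicExtension_iterate_zero (T : ℝ → ℝ) (p : ℕ) (x : ℝ) (k : ℕ) (hk : k + 1 ≤ p) :
    (cyclicExtension T p)^[k + 1] (x, 0) = (T x, ((k + 1 : ℕ) : ZMod p)) := by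
  rw [Function.iterate_succ_apply]
  have : cyclicExtension T p (x, 0) = (T x, ((1 : ℕ) : ZMod p)) := by simp [cyclicExtension]
  rw [this, cyclicExtension_iterate_of_pos T p _ 1 k one_pos (by omega), add_comm]

/-- The `p`-th power of `F(T, p)` is `T × Id`. -/
theorem cyclicExtension_iterate_period (T : ℝ → ℝ) (p : ℕ) (hp : 1 < p) (q : ℝ × ZMod p) :
    (cyclicExtension T p)^[p] q = (T q.1, q.2) := by
  have : NeZero p := ⟨by omega⟩
  obtain ⟨x, z⟩ := q
  obtain ⟨v, hv, rfl⟩ : ∃ v : ℕ, v < p ∧ (v : ZMod p) = z := ⟨z.val, z.val_lt, by simp⟩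
  rcases Nat.eq_zero_or_pos v with rfl | hpos
  · have := cyclicExtension_iterate_zero T p x (p - 1) (by omega)
    rw [Nat.sub_add_cancel (by omega)] at this
    simpa using this
  -- A full turn is `p - v` steps up to floor `0`, then `v` steps back to floor `v`; `T` acts once,
  -- at the start of the second stretch.
  · have h1 := cyclicExtension_iterate_of_pos T p x v (p - v) hpos (by omega)
    have h2 := cyclicExtension_iterate_zero T p x (v - 1) (by omega)
    rw [Nat.add_sub_cancel' hv.le, ZMod.natCast_self] at h1
    rw [Nat.sub_add_cancel hpos] at h2
    have h3 := Function.iterate_add_apply (cyclicExtension T p) v (p - v) (x, (v : ZMod p))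
    rwa [h1, h2, Nat.add_sub_cancel' hv.le] at h3

theorem cyclicExtension_iterate_mul (T : ℝ → ℝ) (p : ℕ) (hp : 1 < p) (k : ℕ) (q : ℝ × ZMod p) :
    (cyclicExtension T p)^[p * k] q = (T^[k] q.1, q.2) := by
  rw [Function.iterate_mul]
  induction k with
  | zero => rfl
  | succ k ih =>
    rw [Function.iterate_succ_apply', ih, cyclicExtension_iterate_period T p hp,
      Function.iterate_succ_apply']

/-- On rectangles the power `p * m i` acts as `T^[m i]` on the first side and leaves the second
alone, so the finite factor is a constant multiplier. -/
theorem WeakPowerLimit.cyclicExtension {T : ℝ → ℝ} {hT : MeasurePreserving T volume volume}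
    {m : ℕ → ℕ} {c : ℝ} (h : WeakPowerLimit (koopman hT) m c) (p : ℕ) (hp : 1 < p) :
    WeakPowerLimit (koopman (cyclicExtension_measurePreserving hT p hp)) (fun i => p * m i) c := by
  have : NeZero p := ⟨by omega⟩
  obtain ⟨S, hS, hcov⟩ := (finiteMeasureSets_isCountablySpanning (volume : Measure ℝ)).prod
    (isCountablySpanning_measurableSet (α := ZMod p))
  refine weakPowerLimit_of_piSystem _
    (generateFrom_eq_prod (finiteMeasureSets_generating (volume : Measure ℝ))
      MeasurableSpace.generateFrom_measurableSet (finiteMeasureSets_isCountablySpanning volume)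
      isCountablySpanning_measurableSet).symm
    ((finiteMeasureSets_isPiSystem volume).prod MeasurableSpace.isPiSystem_measurableSet)
    S hS hcov ?_ ?_
  · rintro _ ⟨A, hA, B, hB, rfl⟩
    rw [extMeasure, Measure.prod_prod]
    exact ENNReal.mul_ne_top hA.2 (measure_ne_top _ _)
  · rintro _ ⟨A, hA, B, hB, rfl⟩ _ ⟨A', hA', B', hB', rfl⟩
    have hset : ∀ k : ℕ, A ×ˢ B ∩ (_root_.cyclicExtension T p)^[p * k] ⁻¹' (A' ×ˢ B') =
        (A ∩ T^[k] ⁻¹' A') ×ˢ (B ∩ B') := by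
      intro k
      ext q
      simp only [Set.mem_inter_iff, Set.mem_prod, Set.mem_preimage,
        cyclicExtension_iterate_mul T p hp]
      tauto
    simp_rw [hset, Set.prod_inter_prod, extMeasure, measureReal_prod_prod, ← mul_assoc]
    exact (h.tendsto_measure hA.1 hA'.1 hA.2 hA'.2).mul_const _

/-! ### Fourier coefficients of measures on the circle -/

/-- The character `z ↦ z ^ n` of the circle as a continuous function. -/
def circleMonomial (n : ℤ) : C(Circle, ℂ) where
  toFun z := ((z ^ n : Circle) : ℂ)
  continuous_toFun := continuous_subtype_val.comp (continuous_zpow n)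

theorem circleMonomial_apply (n : ℤ) (z : Circle) : circleMonomial n z = (z : ℂ) ^ n := by
  simp [circleMonomial]

/-- The star subalgebra of `C(Circle, ℂ)` generated by the characters. -/
def circlePolynomials : StarSubalgebra ℂ C(Circle, ℂ) where
  toSubalgebra := Algebra.adjoin ℂ (Set.range circleMonomial)
  star_mem' := by
    change Algebra.adjoin ℂ (Set.range circleMonomial) ≤
      star (Algebra.adjoin ℂ (Set.range circleMonomial))
    refine Algebra.adjoin_le ?_
    rintro - ⟨n, rfl⟩
    refine Algebra.subset_adjoin ⟨-n, ContinuousMap.ext fun z => ?_⟩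
    simp only [circleMonomial, ContinuousMap.coe_mk, ContinuousMap.star_apply, zpow_neg,
      Circle.coe_inv_eq_conj]
    rfl

theorem circlePolynomials_coe :
    Subalgebra.toSubmodule circlePolynomials.toSubalgebra =
      Submodule.span ℂ (Set.range circleMonomial) := by
  apply Algebra.adjoin_eq_span_of_subset
  refine Set.Subset.trans ?_ Submodule.subset_span
  intro x hx
  refine Submonoid.closure_induction (fun _ => id) ⟨0, ?_⟩ ?_ hx
  · ext1 z; simp [circleMonomial]
  · rintro - - - - ⟨m, rfl⟩ ⟨n, rfl⟩
    refine ⟨m + n, ?_⟩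
    ext1 z
    simp only [circleMonomial, ContinuousMap.coe_mk, ContinuousMap.mul_apply, zpow_add,
      Circle.coe_mul]

/-- Stone–Weierstrass: the character $z$ already separates points. -/
theorem span_circleMonomial_closure_eq_top :
    (Submodule.span ℂ (Set.range circleMonomial)).topologicalClosure = ⊤ := by
  have hsep : circlePolynomials.SeparatesPoints := by
    intro x y hxy
    refine ⟨_, ⟨circleMonomial 1, Algebra.subset_adjoin ⟨1, rfl⟩, rfl⟩, ?_⟩
    simpa [circleMonomial, Circle.coe_inj] using hxy
  rw [← circlePolynomials_coe]
  exact congr_arg (Subalgebra.toSubmodule <| StarSubalgebra.toSubalgebra ·)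
    (ContinuousMap.starSubalgebra_topologicalClosure_eq_top_of_separatesPoints _ hsep)

theorem ContinuousMap.integrable_circle (σ : Measure Circle) [IsFiniteMeasure σ]
    (f : C(Circle, ℂ)) : Integrable (fun z => f z) σ :=
  Integrable.of_bound f.continuous.aestronglyMeasurable ‖f‖
    (Eventually.of_forall fun z => f.norm_coe_le_norm z)

theorem norm_circleMonomial_apply (n : ℤ) (z : Circle) : ‖circleMonomial n z‖ = 1 := by
  rw [circleMonomial, ContinuousMap.coe_mk, Circle.norm_coe]

theorem integral_circleMonomial_neg (σ : Measure Circle) (n : ℤ) :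
    ∫ z, circleMonomial (-n) z ∂σ = (starRingEnd ℂ) (∫ z, circleMonomial n z ∂σ) := by
  rw [← integral_conj]
  congr 1; ext z
  simp only [circleMonomial, ContinuousMap.coe_mk, zpow_neg, Circle.coe_inv_eq_conj]

theorem integral_norm_le_of_circle (σ : Measure Circle) [IsFiniteMeasure σ] (f : C(Circle, ℂ)) :
    ∫ z, ‖f z‖ ∂σ ≤ σ.real Set.univ * ‖f‖ := by
  have := integral_mono (μ := σ) (ContinuousMap.integrable_circle σ f).norm
    (integrable_const ‖f‖) (fun z => f.norm_coe_le_norm z)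
  simpa using this

/-- Finite measures on the circle are determined by their Fourier coefficients. -/
theorem circle_measure_ext {σ τ : Measure Circle} [IsFiniteMeasure σ] [IsFiniteMeasure τ]
    (h : ∀ n : ℕ, ∫ z : Circle, (z : ℂ) ^ n ∂σ = ∫ z : Circle, (z : ℂ) ^ n ∂τ) : σ = τ := by
  have hnat : ∀ n : ℕ, ∫ z, circleMonomial n z ∂σ = ∫ z, circleMonomial n z ∂τ := fun n => by
    simpa [circleMonomial_apply] using h n
  have hint : ∀ n : ℤ, ∫ z, circleMonomial n z ∂σ = ∫ z, circleMonomial n z ∂τ := by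
    intro n
    obtain ⟨k, rfl | rfl⟩ := n.eq_nat_or_neg
    · exact hnat k
    · rw [integral_circleMonomial_neg, integral_circleMonomial_neg, hnat]
  have hall : ∀ f : C(Circle, ℂ), ∫ z, f z ∂σ = ∫ z, f z ∂τ := by
    intro f
    -- The density lemma is applied to a constant sequence, for which tending to zero means
    -- vanishing.
    have := tendsto_zero_of_dense_span (H := C(Circle, ℂ))
      (fun _ f => ∫ z, f z ∂σ - ∫ z, f z ∂τ) (fun _ f g => ?_) (fun _ c f => ?_)
      (σ.real Set.univ + τ.real Set.univ) (fun _ f => ?_) _ span_circleMonomial_closure_eq_top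
      ?_ f
    · exact sub_eq_zero.1 (tendsto_nhds_unique tendsto_const_nhds this)
    · simp only [ContinuousMap.add_apply]
      rw [integral_add (ContinuousMap.integrable_circle σ f) (ContinuousMap.integrable_circle σ g),
        integral_add (ContinuousMap.integrable_circle τ f) (ContinuousMap.integrable_circle τ g)]
      ring
    · simp only [ContinuousMap.smul_apply]
      rw [integral_smul, integral_smul, ← smul_sub, norm_smul]
    · refine (norm_sub_le _ _).trans ?_
      rw [add_mul]
      exact add_le_add ((norm_integral_le_integral_norm _).trans (integral_norm_le_of_circle σ f))
        ((norm_integral_le_integral_norm _).trans (integral_norm_le_of_circle τ f))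
    · rintro _ ⟨n, rfl⟩
      simp [hint]
  refine ext_of_forall_integral_eq_of_IsFiniteMeasure fun f => ?_
  have := hall ⟨fun z => ((f z : ℝ) : ℂ), Complex.continuous_ofReal.comp f.continuous⟩
  simp only [ContinuousMap.coe_mk, integral_complex_ofReal] at this
  exact_mod_cast this

/-- Along the exponents `k i` the characters `z ^ k i` converge weakly to the constant `c` on the
characters in `L²(σ)`. -/
def MonomialLimit (σ : Measure Circle) (k : ℕ → ℕ) (c : ℝ) : Prop :=
  ∀ j : ℤ, Tendsto (fun i => ∫ z, circleMonomial (k i + j) z ∂σ) atTop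
    (𝓝 ((c : ℂ) * ∫ z, circleMonomial j z ∂σ))

theorem integral_circleMonomial_mconv (σ τ : Measure Circle) [IsFiniteMeasure σ]
    [IsFiniteMeasure τ] (n : ℤ) :
    ∫ z, circleMonomial n z ∂(σ.mconv τ) =
      (∫ z, circleMonomial n z ∂σ) * ∫ z, circleMonomial n z ∂τ := by
  rw [Measure.mconv, integral_map (by fun_prop)
    (circleMonomial n).continuous.aestronglyMeasurable, ← integral_prod_mul]
  congr 1; ext x
  simp [circleMonomial, mul_zpow]

/-- Fourier coefficients of a convolution are products, hence so are their limits. -/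
theorem MonomialLimit.mconv {σ τ : Measure Circle} [IsFiniteMeasure σ] [IsFiniteMeasure τ]
    {k : ℕ → ℕ} {c d : ℝ} (hσ : MonomialLimit σ k c) (hτ : MonomialLimit τ k d) :
    MonomialLimit (σ.mconv τ) k (c * d) := by
  intro j
  simp_rw [integral_circleMonomial_mconv]
  convert (hσ j).mul (hτ j) using 2
  push_cast; ring

theorem isFiniteMeasure_convPower (σ : Measure Circle) [IsFiniteMeasure σ] (n : ℕ) :
    IsFiniteMeasure (convPower σ n) := by
  induction n with
  | zero => unfold convPower; infer_instance
  | succ n ih => unfold convPower; infer_instance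

theorem MonomialLimit.convPower {σ : Measure Circle} [IsFiniteMeasure σ] {k : ℕ → ℕ} {c : ℝ}
    (hσ : MonomialLimit σ k c) (n : ℕ) : MonomialLimit (convPower σ n) k (c ^ n) := by
  induction n with
  | zero =>
    intro j
    simp [_root_.convPower, circleMonomial]
  | succ n ih =>
    have := isFiniteMeasure_convPower σ n
    rw [pow_succ]
    exact ih.mconv hσ

/-- Characters have modulus one and span a dense subspace of $L^1(\sigma)$, so the limit extends to
every integrable density. This transfers it to measures absolutely continuous with respect to `σ`.
-/
theorem MonomialLimit.integral_mul {σ : Measure Circle} [IsFiniteMeasure σ] {k : ℕ → ℕ} {c : ℝ}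
    (hσ : MonomialLimit σ k c) {h : Circle → ℂ} (hh : Integrable h σ) :
    Tendsto (fun i => ∫ z, circleMonomial (k i) z * h z ∂σ) atTop
      (𝓝 ((c : ℂ) * ∫ z, h z ∂σ)) := by
  have hmul : ∀ n : ℤ, ∀ f : Circle → ℂ, Integrable f σ →
      Integrable (fun z => circleMonomial n z * f z) σ := fun n f hf =>
    hf.bdd_mul (circleMonomial n).continuous.aestronglyMeasurable
      (Eventually.of_forall fun z => (norm_circleMonomial_apply n z).le)
  have hcont : (Submodule.span ℂ (Set.range fun n =>
      (ContinuousMap.toLp 1 σ ℂ (circleMonomial n) : Lp ℂ 1 σ))).topologicalClosure = ⊤ := by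
    convert! (ContinuousMap.toLp_denseRange (p := 1) ℂ σ ℂ
      ENNReal.one_ne_top).topologicalClosure_map_submodule span_circleMonomial_closure_eq_top
    rw [Submodule.map_span, Set.range_comp']
    simp only [ContinuousLinearMap.coe_coe]
  have key := tendsto_zero_of_dense_span (H := Lp ℂ 1 σ)
    (fun i f => ∫ z, circleMonomial (k i) z * f z ∂σ - (c : ℂ) * ∫ z, f z ∂σ)
    (fun i f g => ?_) (fun i a f => ?_) (1 + |c|) (fun i f => ?_) _ hcont ?_ (hh.toL1 h)
  · have e : ∀ i, ∫ z, circleMonomial (k i) z * (hh.toL1 h) z ∂σ =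
        ∫ z, circleMonomial (k i) z * h z ∂σ := fun i =>
      integral_congr_ae (by filter_upwards [hh.coeFn_toL1] with z hz using by rw [hz])
    have e' : ∫ z, (hh.toL1 h) z ∂σ = ∫ z, h z ∂σ := integral_congr_ae hh.coeFn_toL1
    simp_rw [e, e'] at key
    exact tendsto_sub_nhds_zero_iff.1 key
  · have e : (f + g : Lp ℂ 1 σ) =ᵐ[σ] fun z => f z + g z := Lp.coeFn_add f g
    have e1 : ∫ z, circleMonomial (k i) z * (f + g : Lp ℂ 1 σ) z ∂σ =
        ∫ z, (circleMonomial (k i) z * f z + circleMonomial (k i) z * g z) ∂σ :=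
      integral_congr_ae (by filter_upwards [e] with z hz using by rw [hz]; ring)
    rw [e1, integral_congr_ae e, integral_add (hmul _ _ (L1.integrable_coeFn f))
      (hmul _ _ (L1.integrable_coeFn g)),
      integral_add (L1.integrable_coeFn f) (L1.integrable_coeFn g)]
    ring
  · have e : (a • f : Lp ℂ 1 σ) =ᵐ[σ] fun z => a * f z := Lp.coeFn_smul a f
    have e1 : ∫ z, circleMonomial (k i) z * (a • f : Lp ℂ 1 σ) z ∂σ =
        ∫ z, a * (circleMonomial (k i) z * f z) ∂σ :=
      integral_congr_ae (by filter_upwards [e] with z hz using by rw [hz]; ring)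
    rw [e1, integral_congr_ae e, integral_const_mul, integral_const_mul, ← norm_mul]
    ring_nf
  · have e1 : ‖∫ z, circleMonomial (k i) z * f z ∂σ‖ ≤ ‖f‖ := by
      refine (norm_integral_le_integral_norm _).trans ?_
      rw [L1.norm_eq_integral_norm]
      simp [norm_circleMonomial_apply]
    have e2 : ‖∫ z, f z ∂σ‖ ≤ ‖f‖ := by
      refine (norm_integral_le_integral_norm _).trans ?_
      rw [L1.norm_eq_integral_norm]
    refine (norm_sub_le _ _).trans ?_
    rw [norm_mul, Complex.norm_real, Real.norm_eq_abs, add_mul, one_mul]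
    exact add_le_add e1 (mul_le_mul_of_nonneg_left e2 (abs_nonneg c))
  · rintro _ ⟨j, rfl⟩
    have e := ContinuousMap.coeFn_toLp (p := 1) (𝕜 := ℂ) σ (circleMonomial j)
    have e1 : ∀ i, ∫ z, circleMonomial (k i) z *
        (ContinuousMap.toLp 1 σ ℂ (circleMonomial j) : Lp ℂ 1 σ) z ∂σ =
        ∫ z, circleMonomial (k i + j) z ∂σ := fun i =>
      integral_congr_ae (by
        filter_upwards [e] with z hz
        rw [hz]
        simp only [circleMonomial, ContinuousMap.coe_mk, zpow_add, Circle.coe_mul])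
    simp_rw [e1, integral_congr_ae e]
    exact tendsto_sub_nhds_zero_iff.2 (hσ j)

/-- Measures with different weak limits of the same characters are mutually singular. -/
theorem MonomialLimit.mutuallySingular {σ τ : Measure Circle} [IsFiniteMeasure σ]
    [IsFiniteMeasure τ] {k : ℕ → ℕ} {c d : ℝ} (hσ : MonomialLimit σ k c)
    (hτ : MonomialLimit τ k d) (hcd : c ≠ d) : σ ⟂ₘ τ := by
  -- `B` is null for the part of `τ` singular to `σ`, and its complement is `σ`-null; it remains to
  -- show `τ B = 0`.
  obtain ⟨B, hB, hB1, hB2⟩ := τ.mutuallySingular_singularPart σ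
  have hac : τ.restrict B ≪ σ := by
    refine Measure.AbsolutelyContinuous.mk fun A hA hσA => ?_
    rw [Measure.restrict_apply hA, τ.haveLebesgueDecomposition_add σ, Measure.add_apply,
      measure_mono_null Set.inter_subset_right hB1, zero_add]
    exact measure_mono_null Set.inter_subset_left (withDensity_absolutelyContinuous σ _ hσA)
  -- The measure `τ.restrict B` is seen once as a density over `σ` and once as an indicator over
  -- `τ`; the characters then give both `c * τ.real B` and `d * τ.real B`.
  have h1 := hσ.integral_mul (h := fun z => (((τ.restrict B).rnDeriv σ z).toReal : ℂ))
    Measure.integrable_toReal_rnDeriv.ofReal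
  have h2 := hτ.integral_mul (h := B.indicator fun _ => 1)
    ((integrable_const (1 : ℂ)).indicator hB)
  have e1 : ∀ f : Circle → ℂ, ∫ z, f z * (((τ.restrict B).rnDeriv σ z).toReal : ℂ) ∂σ =
      ∫ z in B, f z ∂τ := fun f => by
    rw [← integral_rnDeriv_smul hac]
    congr 1; ext z
    rw [Complex.real_smul, mul_comm]
  have e2 : ∀ f : Circle → ℂ, ∫ z, f z * (B.indicator (fun _ => (1 : ℂ)) z) ∂τ =
      ∫ z in B, f z ∂τ := fun f => by
    rw [← integral_indicator hB]
    congr 1; ext z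
    by_cases hz : z ∈ B <;> simp [hz]
  have e3 : ∫ z, (((τ.restrict B).rnDeriv σ z).toReal : ℂ) ∂σ = τ.real B := by
    simpa using e1 fun _ => 1
  have e4 : ∫ z, (B.indicator (fun _ => (1 : ℂ)) z) ∂τ = τ.real B := by
    simpa using e2 fun _ => 1
  simp_rw [e1, e3] at h1
  simp_rw [e2, e4] at h2
  have h3 := tendsto_nhds_unique h1 h2
  have h4 : τ.real B = 0 := by
    by_contra hne
    exact hcd (by exact_mod_cast mul_right_cancel₀ (Complex.ofReal_ne_zero.2 hne) h3)
  refine ⟨Bᶜ, hB.compl, hB2, ?_⟩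
  rw [compl_compl]
  exact (measureReal_eq_zero_iff).1 h4

/-! ### Spectral measures of unitary operators -/

section Spectral

variable {H : Type*} [NormedAddCommGroup H] [InnerProductSpace ℂ H] [CompleteSpace H]

/-- The inclusion of the spectrum of a unitary operator into the circle. -/
def spectrumToCircle {U : H →L[ℂ] H} (hU : U ∈ unitary (H →L[ℂ] H)) :
    C(spectrum ℂ U, Circle) where
  toFun z := ⟨z, mem_sphere_zero_iff_norm.2 (spectrum.norm_eq_one_of_unitary hU z.2)⟩
  continuous_toFun := by fun_prop

/-- Functional calculus of a unitary operator with continuous functions on the circle. -/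
def circleCalculus {U : H →L[ℂ] H} (hU : U ∈ unitary (H →L[ℂ] H)) :
    C(Circle, ℂ) →⋆ₐ[ℂ] (H →L[ℂ] H) :=
  (cfcHom (R := ℂ) (isStarNormal_of_mem_unitary hU)).comp
    (ContinuousMap.compStarAlgHom' ℂ ℂ (spectrumToCircle hU))

theorem circleCalculus_pow {U : H →L[ℂ] H} (hU : U ∈ unitary (H →L[ℂ] H)) (n : ℕ) :
    circleCalculus hU (circleMonomial n) = U ^ n := by
  have h1 : circleMonomial n = circleMonomial 1 ^ n := by
    ext z; simp [circleMonomial]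
  rw [h1, map_pow]
  congr 1
  conv_rhs => rw [← cfcHom_id (R := ℂ) (isStarNormal_of_mem_unitary hU)]
  change cfcHom (R := ℂ) (isStarNormal_of_mem_unitary hU) _ = _
  congr 1
  ext z
  simp [circleMonomial, spectrumToCircle]
  rfl

/-- The positive functional `f ↦ ⟪x, f(U) x⟫` on real continuous functions on the circle. -/
def spectralFunctional {U : H →L[ℂ] H} (hU : U ∈ unitary (H →L[ℂ] H)) (x : H) :
    C(Circle, ℝ) →ₗ[ℝ] ℝ where
  toFun f := (⟪x, circleCalculus hU
    ⟨fun z => ((f z : ℝ) : ℂ), Complex.continuous_ofReal.comp f.continuous⟩ x⟫_ℂ).re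
  map_add' f g := by
    rw [← Complex.add_re, ← inner_add_right, ← add_apply, ← map_add]
    congr 5; ext z; simp
  map_smul' r f := by
    have : (⟨fun z => (((r • f) z : ℝ) : ℂ), Complex.continuous_ofReal.comp (r • f).continuous⟩ :
        C(Circle, ℂ)) = (r : ℂ) • ⟨fun z => ((f z : ℝ) : ℂ),
          Complex.continuous_ofReal.comp f.continuous⟩ := by
      ext z; simp
    rw [this, map_smul, smul_apply, inner_smul_right, Complex.re_ofReal_mul]
    rfl

/-- With $g=\sqrt f$ one has $f=\bar g g$, so the inner product is $\|g(U)x\|^2$: real and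
nonnegative at once. -/
theorem inner_circleCalculus_nonneg {U : H →L[ℂ] H} (hU : U ∈ unitary (H →L[ℂ] H)) (x : H)
    (f : C(Circle, ℝ)) (hf : ∀ z, 0 ≤ f z) :
    ⟪x, circleCalculus hU
      ⟨fun z => ((f z : ℝ) : ℂ), Complex.continuous_ofReal.comp f.continuous⟩ x⟫_ℂ =
      (spectralFunctional hU x f : ℂ) ∧ 0 ≤ spectralFunctional hU x f := by
  set g : C(Circle, ℂ) := ⟨fun z => ((Real.sqrt (f z) : ℝ) : ℂ),
    Complex.continuous_ofReal.comp (Real.continuous_sqrt.comp f.continuous)⟩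
  have hg : (⟨fun z => ((f z : ℝ) : ℂ), Complex.continuous_ofReal.comp f.continuous⟩ :
      C(Circle, ℂ)) = star g * g := by
    ext z
    simp only [g, ContinuousMap.coe_mk, ContinuousMap.mul_apply, ContinuousMap.star_apply]
    rw [Complex.star_def, Complex.conj_ofReal, ← Complex.ofReal_mul, Real.mul_self_sqrt (hf z)]
  have h1 : ⟪x, circleCalculus hU
      ⟨fun z => ((f z : ℝ) : ℂ), Complex.continuous_ofReal.comp f.continuous⟩ x⟫_ℂ =
      ((‖circleCalculus hU g x‖ ^ 2 : ℝ) : ℂ) := by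
    rw [hg, map_mul, map_star, mul_apply_eq_comp, ContinuousLinearMap.star_eq_adjoint,
      ContinuousLinearMap.adjoint_inner_right, inner_self_eq_norm_sq_to_K]
    norm_cast
  have h2 : spectralFunctional hU x f = ‖circleCalculus hU g x‖ ^ 2 := by
    change (⟪x, circleCalculus hU _ x⟫_ℂ).re = _
    rw [h1, Complex.ofReal_re]
  rw [h1, h2]
  exact ⟨rfl, by positivity⟩

/-- Write $f=(f+\|f\|)-\|f\|$ as a difference of nonnegative functions. -/
theorem inner_circleCalculus_real {U : H →L[ℂ] H} (hU : U ∈ unitary (H →L[ℂ] H)) (x : H)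
    (f : C(Circle, ℝ)) :
    ⟪x, circleCalculus hU
      ⟨fun z => ((f z : ℝ) : ℂ), Complex.continuous_ofReal.comp f.continuous⟩ x⟫_ℂ =
      (spectralFunctional hU x f : ℂ) := by
  have h1 := (inner_circleCalculus_nonneg hU x (f + ‖f‖ • 1) fun z => by
    have := neg_le_of_abs_le (f.norm_coe_le_norm z)
    simp
    linarith).1
  have h2 := (inner_circleCalculus_nonneg hU x (‖f‖ • 1) fun z => by simp).1
  have h3 : (⟨fun z => ((f z : ℝ) : ℂ), Complex.continuous_ofReal.comp f.continuous⟩ :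
      C(Circle, ℂ)) = ⟨fun z => (((f + ‖f‖ • 1 : C(Circle, ℝ)) z : ℝ) : ℂ),
        Complex.continuous_ofReal.comp (f + ‖f‖ • 1 : C(Circle, ℝ)).continuous⟩ -
        ⟨fun z => (((‖f‖ • 1 : C(Circle, ℝ)) z : ℝ) : ℂ),
        Complex.continuous_ofReal.comp (‖f‖ • 1 : C(Circle, ℝ)).continuous⟩ := by
    ext z; simp
  rw [h3, map_sub, sub_apply, inner_sub_right, h1, h2, map_add]
  push_cast; ring

/-- Every vector has a spectral measure. -/
theorem exists_isSpectralMeasureOf {U : H →L[ℂ] H} (hU : U ∈ unitary (H →L[ℂ] H)) (x : H) :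
    ∃ σ, IsSpectralMeasureOf U x σ := by
  -- Riesz–Markov–Kakutani represents this positive functional by a measure, finite because the
  -- circle is compact.
  let Λ : CompactlySupportedContinuousMap Circle ℝ →ₚ[ℝ] ℝ := PositiveLinearMap.mk₀
    { toFun := fun f => spectralFunctional hU x f.toContinuousMap
      map_add' := fun f g => map_add (spectralFunctional hU x) f.toContinuousMap g.toContinuousMap
      map_smul' := fun r f => map_smul (spectralFunctional hU x) r f.toContinuousMap }
    fun f hf => (inner_circleCalculus_nonneg hU x f.toContinuousMap hf).2
  have hfin : IsFiniteMeasure (RealRMK.rieszMeasure Λ) := inferInstance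
  have hreal : ∀ f : C(Circle, ℝ), ∫ z, f z ∂(RealRMK.rieszMeasure Λ) =
      spectralFunctional hU x f := fun f =>
    RealRMK.integral_rieszMeasure Λ (CompactlySupportedContinuousMap.continuousMapEquiv f)
  refine ⟨RealRMK.rieszMeasure Λ, hfin, fun n => ?_⟩
  let u : C(Circle, ℝ) := ⟨fun z => (circleMonomial n z).re,
    Complex.continuous_re.comp (circleMonomial n).continuous⟩
  let v : C(Circle, ℝ) := ⟨fun z => (circleMonomial n z).im,
    Complex.continuous_im.comp (circleMonomial n).continuous⟩
  have hdec : circleMonomial n =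
      ⟨fun z => ((u z : ℝ) : ℂ), Complex.continuous_ofReal.comp u.continuous⟩ +
      Complex.I • ⟨fun z => ((v z : ℝ) : ℂ), Complex.continuous_ofReal.comp v.continuous⟩ := by
    ext z
    simp only [u, v, ContinuousMap.coe_mk, ContinuousMap.add_apply, ContinuousMap.smul_apply,
      smul_eq_mul, mul_comm Complex.I, Complex.re_add_im]
  have h1 : ∫ z : Circle, (z : ℂ) ^ n ∂(RealRMK.rieszMeasure Λ) =
      ((∫ z, u z ∂(RealRMK.rieszMeasure Λ) : ℝ) : ℂ) +
        Complex.I * ((∫ z, v z ∂(RealRMK.rieszMeasure Λ) : ℝ) : ℂ) := by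
    have h2 := integral_re_add_im (ContinuousMap.integrable_circle
      (RealRMK.rieszMeasure Λ) (circleMonomial n))
    simp only [circleMonomial_apply, zpow_natCast] at h2
    rw [← h2, mul_comm Complex.I]
    simp [u, v, circleMonomial_apply]
  rw [h1, hreal, hreal, ← circleCalculus_pow hU, hdec, map_add, map_smul,
    add_apply, smul_apply, inner_add_right,
    inner_smul_right, inner_circleCalculus_real, inner_circleCalculus_real]

end Spectral

/-! ### The maximal spectral type -/

section MaximalType

variable {H : Type*} [NormedAddCommGroup H] [InnerProductSpace ℂ H]

theorem IsSpectralMeasureOf.unique {U : H →L[ℂ] H} {x : H} {ρ τ : Measure Circle}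
    (hρ : IsSpectralMeasureOf U x ρ) (hτ : IsSpectralMeasureOf U x τ) : ρ = τ := by
  have := hρ.1
  have := hτ.1
  exact circle_measure_ext fun n => (hρ.2 n).trans (hτ.2 n).symm

theorem integrable_circle_pow (σ : Measure Circle) [IsFiniteMeasure σ] (n : ℕ) :
    Integrable (fun z : Circle => (z : ℂ) ^ n) σ := by
  simpa [circleMonomial_apply] using ContinuousMap.integrable_circle σ (circleMonomial n)

/-- Spectral measures add for vectors with orthogonal cyclic subspaces. -/
theorem IsSpectralMeasureOf.add {U : H →L[ℂ] H} {x y : H} {ρ τ : Measure Circle}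
    (hρ : IsSpectralMeasureOf U x ρ) (hτ : IsSpectralMeasureOf U y τ)
    (h : ∀ n : ℕ, ⟪x, (U ^ n) y⟫_ℂ + ⟪y, (U ^ n) x⟫_ℂ = 0) :
    IsSpectralMeasureOf U (x + y) (ρ + τ) := by
  have := hρ.1
  have := hτ.1
  refine ⟨inferInstance, fun n => ?_⟩
  rw [integral_add_measure (integrable_circle_pow ρ n) (integrable_circle_pow τ n), hρ.2, hτ.2,
    map_add, inner_add_left, inner_add_right, inner_add_right]
  linear_combination -(h n)

theorem IsSpectralMeasureOf.smul {U : H →L[ℂ] H} {x : H} {ρ : Measure Circle}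
    (hρ : IsSpectralMeasureOf U x ρ) (c : ℂ) :
    IsSpectralMeasureOf U (c • x) (ENNReal.ofReal (‖c‖ ^ 2) • ρ) := by
  have := hρ.1
  refine ⟨ρ.smul_finite ENNReal.ofReal_ne_top, fun n => ?_⟩
  rw [integral_smul_measure, ENNReal.toReal_ofReal (by positivity), hρ.2, map_smul,
    inner_smul_left, inner_smul_right, Complex.real_smul, ← mul_assoc,
    ← Complex.normSq_eq_conj_mul_self,
    Complex.normSq_eq_norm_sq]

/-- The parallelogram law for spectral measures. -/
theorem IsSpectralMeasureOf.parallelogram {U : H →L[ℂ] H} {x y : H} {ρ τ s d : Measure Circle}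
    (hρ : IsSpectralMeasureOf U x ρ) (hτ : IsSpectralMeasureOf U y τ)
    (hs : IsSpectralMeasureOf U (x + y) s) (hd : IsSpectralMeasureOf U (x - y) d) :
    s + d = (ρ + ρ) + (τ + τ) := by
  have := hρ.1
  have := hτ.1
  have := hs.1
  have := hd.1
  refine circle_measure_ext fun n => ?_
  rw [integral_add_measure (integrable_circle_pow s n) (integrable_circle_pow d n),
    integral_add_measure (integrable_circle_pow _ n) (integrable_circle_pow _ n),
    integral_add_measure (integrable_circle_pow ρ n) (integrable_circle_pow ρ n),
    integral_add_measure (integrable_circle_pow τ n) (integrable_circle_pow τ n),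
    hρ.2, hτ.2, hs.2, hd.2, map_add, map_sub]
  simp only [inner_add_left, inner_add_right, inner_sub_left, inner_sub_right]
  ring

theorem IsSpectralMeasureOf.measure_univ {U : H →L[ℂ] H} {x : H} {ρ : Measure Circle}
    (hρ : IsSpectralMeasureOf U x ρ) : ρ Set.univ = ENNReal.ofReal (‖x‖ ^ 2) := by
  have := hρ.1
  have h := hρ.2 0
  simp only [pow_zero, integral_const, one_apply_eq_self, inner_self_eq_norm_sq_to_K] at h
  have h2 : ρ.real Set.univ = ‖x‖ ^ 2 := by
    rw [Complex.real_smul, mul_one] at h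
    exact Complex.ofReal_injective (by rw [h]; norm_cast)
  rw [← h2, Measure.real, ENNReal.ofReal_toReal (measure_ne_top _ _)]

/-- The vectors `x` and `y` generate orthogonal cyclic subspaces. -/
def CyclicOrthogonal (U : H →L[ℂ] H) (x y : H) : Prop :=
  ∀ n : ℕ, ⟪x, (U ^ n) y⟫_ℂ = 0 ∧ ⟪y, (U ^ n) x⟫_ℂ = 0

/-- A maximal set of unit vectors with pairwise orthogonal cyclic subspaces. -/
theorem exists_maximal_cyclicOrthogonal (U : H →L[ℂ] H) :
    ∃ G : Set H, (∀ x ∈ G, ‖x‖ = 1) ∧ G.Pairwise (CyclicOrthogonal U) ∧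
      ∀ y : H, ‖y‖ = 1 → (∀ x ∈ G, CyclicOrthogonal U x y) → y ∈ G := by
  obtain ⟨G, hG⟩ := zorn_subset
    {G : Set H | (∀ x ∈ G, ‖x‖ = 1) ∧ G.Pairwise (CyclicOrthogonal U)} (by
      intro c hc hchain
      refine ⟨⋃₀ c, ⟨?_, ?_⟩, fun s hs => Set.subset_sUnion_of_mem hs⟩
      · rintro x ⟨s, hs, hx⟩
        exact (hc hs).1 x hx
      · exact (Set.pairwise_sUnion hchain.directedOn).2 fun s hs => (hc hs).2)
  refine ⟨G, hG.prop.1, hG.prop.2, fun y hy hGy => ?_⟩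
  have : insert y G ⊆ G := hG.le_of_ge ⟨?_, ?_⟩ (Set.subset_insert y G)
  · exact this (Set.mem_insert y G)
  · rintro x (rfl | hx)
    · exact hy
    · exact hG.prop.1 x hx
  · refine hG.prop.2.insert fun x hx _ => ⟨fun n => ?_, hGy x hx⟩
    exact (hGy x hx n).symm

/-- Such vectors are orthonormal, at mutual distance $\sqrt2$, so balls of radius `1 / 2` are
disjoint open sets in a separable space. -/
theorem countable_of_cyclicOrthogonal [SecondCountableTopology H] {U : H →L[ℂ] H} {G : Set H}
    (h1 : ∀ x ∈ G, ‖x‖ = 1) (h2 : G.Pairwise (CyclicOrthogonal U)) : G.Countable := by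
  refine Set.PairwiseDisjoint.countable_of_isOpen (s := fun x => Metric.ball x (1 / 2)) ?_
    (fun x _ => Metric.isOpen_ball) (fun x _ => ⟨x, Metric.mem_ball_self (by norm_num)⟩)
  intro x hx y hy hxy
  refine Metric.ball_disjoint_ball ?_
  have h3 : ⟪x, y⟫_ℂ = 0 := by simpa using (h2 hx hy hxy 0).1
  have h4 : ‖x - y‖ ^ 2 = 2 := by
    rw [@norm_sub_sq ℂ, h3, h1 x hx, h1 y hy]; simp; norm_num
  rw [dist_eq_norm]
  nlinarith [norm_nonneg (x - y)]

variable [CompleteSpace H]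

theorem inner_unitary {U : H →L[ℂ] H} (hU : U ∈ unitary (H →L[ℂ] H)) (x y : H) :
    ⟪U x, U y⟫_ℂ = ⟪x, y⟫_ℂ := by
  rw [← ContinuousLinearMap.adjoint_inner_right, ← mul_apply_eq_comp,
    ← ContinuousLinearMap.star_eq_adjoint, Unitary.star_mul_self_of_mem hU]
  rfl

theorem IsSpectralMeasureOf.apply_unitary {U : H →L[ℂ] H} (hU : U ∈ unitary (H →L[ℂ] H)) {x : H}
    {ρ : Measure Circle} : IsSpectralMeasureOf U (U x) ρ ↔ IsSpectralMeasureOf U x ρ := by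
  have h : ∀ n : ℕ, ⟪U x, (U ^ n) (U x)⟫_ℂ = ⟪x, (U ^ n) x⟫_ℂ := fun n => by
    rw [← mul_apply_eq_comp, ← pow_succ, pow_succ', mul_apply_eq_comp, inner_unitary hU]
  simp_rw [IsSpectralMeasureOf, h]

/-- The closed reducing subspace of the vectors whose spectral measures vanish on `A`. -/
def spectralNull {U : H →L[ℂ] H} (hU : U ∈ unitary (H →L[ℂ] H)) (A : Set Circle) :
    Submodule ℂ H where
  carrier := {x | ∀ ρ, IsSpectralMeasureOf U x ρ → ρ A = 0}
  zero_mem' ρ hρ := measure_mono_null (Set.subset_univ A) (by rw [hρ.measure_univ]; simp)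
  add_mem' {x y} hx hy s hs := by
    obtain ⟨ρ, hρ⟩ := exists_isSpectralMeasureOf hU x
    obtain ⟨τ, hτ⟩ := exists_isSpectralMeasureOf hU y
    obtain ⟨d, hd⟩ := exists_isSpectralMeasureOf hU (x - y)
    have h := congrArg (fun μ : Measure Circle => μ A) (hρ.parallelogram hτ hs hd)
    simp only [Measure.add_apply, hx ρ hρ, hy τ hτ, add_zero] at h
    exact (add_eq_zero.1 h).1
  smul_mem' c x hx s hs := by
    obtain ⟨ρ, hρ⟩ := exists_isSpectralMeasureOf hU x
    rw [hs.unique (hρ.smul c), Measure.smul_apply, hx ρ hρ, smul_zero]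

/-- The parallelogram law for `x - y` and `y`, with `y` in the subspace, bounds the measure of `A`
for `x` by $2\|x-y\|^2$; this explains the radius $\sqrt{\varepsilon/2}$. -/
theorem spectralNull_isClosed {U : H →L[ℂ] H} (hU : U ∈ unitary (H →L[ℂ] H)) (A : Set Circle) :
    IsClosed (spectralNull hU A : Set H) := by
  refine isClosed_of_closure_subset fun x hx s hs => ?_
  refine le_antisymm (ENNReal.le_of_forall_pos_le_add fun ε hε _ => ?_) zero_le
  obtain ⟨y, hy, hxy⟩ := Metric.mem_closure_iff.1 hx (Real.sqrt (ε / 2))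
    (Real.sqrt_pos.2 (by positivity))
  obtain ⟨τ, hτ⟩ := exists_isSpectralMeasureOf hU y
  obtain ⟨ρ, hρ⟩ := exists_isSpectralMeasureOf hU (x - y)
  obtain ⟨d, hd⟩ := exists_isSpectralMeasureOf hU ((x - y) - y)
  have hs' : IsSpectralMeasureOf U ((x - y) + y) s := by rwa [sub_add_cancel]
  have h := congrArg (fun μ : Measure Circle => μ A) (hρ.parallelogram hτ hs' hd)
  simp only [Measure.add_apply, hy τ hτ, add_zero] at h
  have h1 : ρ A ≤ ENNReal.ofReal (ε / 2) := by
    refine (measure_mono (Set.subset_univ A)).trans ?_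
    rw [hρ.measure_univ]
    refine ENNReal.ofReal_le_ofReal ?_
    rw [dist_eq_norm] at hxy
    exact (Real.le_sqrt (norm_nonneg _) (by positivity)).1 hxy.le
  calc s A ≤ s A + d A := le_self_add
    _ = ρ A + ρ A := h
    _ ≤ ENNReal.ofReal (ε / 2) + ENNReal.ofReal (ε / 2) := add_le_add h1 h1
    _ = ENNReal.ofReal ε := by
      rw [← ENNReal.ofReal_add (by positivity) (by positivity), add_halves]
    _ = 0 + ε := by rw [zero_add, ENNReal.ofReal_coe_nnreal]

theorem apply_mem_spectralNull {U : H →L[ℂ] H} (hU : U ∈ unitary (H →L[ℂ] H)) (A : Set Circle)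
    {x : H} : U x ∈ spectralNull hU A ↔ x ∈ spectralNull hU A := by
  change (∀ ρ, _ → _) ↔ ∀ ρ, _ → _
  simp_rw [IsSpectralMeasureOf.apply_unitary hU]

theorem pow_apply_mem_spectralNull {U : H →L[ℂ] H} (hU : U ∈ unitary (H →L[ℂ] H))
    (A : Set Circle) (n : ℕ) {x : H} :
    (U ^ n) x ∈ spectralNull hU A ↔ x ∈ spectralNull hU A := by
  induction n with
  | zero => simp
  | succ n ih => rw [pow_succ', mul_apply_eq_comp, apply_mem_spectralNull, ih]

/-- The subspace is invariant under `U ^ n` and its adjoint, so moving powers across the inner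
product keeps `x` inside it. -/
theorem cyclicOrthogonal_of_mem_spectralNull_orthogonal {U : H →L[ℂ] H}
    (hU : U ∈ unitary (H →L[ℂ] H)) {A : Set Circle} {x y : H} (hx : x ∈ spectralNull hU A)
    (hy : y ∈ (spectralNull hU A)ᗮ) : CyclicOrthogonal U x y := by
  intro n
  have hUn : U ^ n ∈ unitary (H →L[ℂ] H) := pow_mem hU n
  have e : (U ^ n) (star (U ^ n) x) = x := by
    rw [← mul_apply_eq_comp, Unitary.mul_star_self_of_mem hUn]; rfl
  constructor
  · rw [← e, inner_unitary hUn]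
    exact Submodule.inner_right_of_mem_orthogonal
      ((pow_apply_mem_spectralNull hU A n).1 (e.symm ▸ hx)) hy
  · exact Submodule.inner_left_of_mem_orthogonal ((pow_apply_mem_spectralNull hU A n).2 hx) hy

/-- A unitary operator on a separable Hilbert space has a vector whose spectral measure is of
maximal spectral type. -/
theorem exists_maximal_spectral_vector [SecondCountableTopology H] {U : H →L[ℂ] H}
    (hU : U ∈ unitary (H →L[ℂ] H)) :
    ∃ (f : H) (σ : Measure Circle), IsSpectralMeasureOf U f σ ∧
      ∀ (x : H) (ρ : Measure Circle), IsSpectralMeasureOf U x ρ → ρ ≪ σ := by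
  obtain ⟨G, hG1, hG2, hG3⟩ := exists_maximal_cyclicOrthogonal U
  have hc : Countable G := (countable_of_cyclicOrthogonal hG1 hG2).to_subtype
  have := Encodable.ofCountable G
  -- Any positive summable weights work: positivity makes the spectral measure of the sum dominate
  -- that of each generator.
  obtain ⟨c, hcpos, _, hcs, _⟩ := posSumOfEncodable one_pos G
  have hsum : Summable fun g : G => (c g : ℂ) • (g : H) := by
    refine Summable.of_norm (hcs.summable.congr fun g => ?_)
    rw [norm_smul, hG1 g g.2, mul_one, Complex.norm_real, Real.norm_of_nonneg (hcpos g).le]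
  set f : H := ∑' g : G, (c g : ℂ) • (g : H)
  have horth : ∀ g h : G, h ≠ g → CyclicOrthogonal U (g : H) h := fun g h hgh =>
    hG2 g.2 h.2 fun e => hgh (Subtype.ext e.symm)
  -- Each term is cyclically orthogonal to the rest of the series, so spectral measures add and an
  -- `A` null for `f` is null for every generator.
  have hsplit : ∀ g : G, CyclicOrthogonal U ((c g : ℂ) • (g : H)) (f - (c g : ℂ) • (g : H)) := by
    intro g n
    have e1 : ⟪(g : H), (U ^ n) f⟫_ℂ = (c g : ℂ) * ⟪(g : H), (U ^ n) g⟫_ℂ := by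
      refine ((innerSL ℂ (g : H) ∘L (U ^ n)).map_tsum hsum).trans
        ((tsum_eq_single g fun h hh => ?_).trans (map_smul _ _ _))
      rw [map_smul, ContinuousLinearMap.comp_apply, innerSL_apply_apply, (horth g h hh n).1,
        smul_zero]
    have e2 : ⟪(U ^ n) (g : H), f⟫_ℂ = (c g : ℂ) * ⟪(U ^ n) (g : H), g⟫_ℂ := by
      refine ((innerSL ℂ ((U ^ n) (g : H))).map_tsum hsum).trans
        ((tsum_eq_single g fun h hh => ?_).trans (map_smul _ _ _))
      rw [map_smul, innerSL_apply_apply, inner_eq_zero_symm.1 (horth g h hh n).2, smul_zero]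
    constructor
    · rw [inner_smul_left, map_sub, inner_sub_right, e1, map_smul, inner_smul_right, sub_self,
        mul_zero]
    · rw [map_smul, inner_smul_right, inner_eq_zero_symm.1, mul_zero]
      rw [inner_sub_right, e2, inner_smul_right, sub_self]
  obtain ⟨σ, hσ⟩ := exists_isSpectralMeasureOf hU f
  refine ⟨f, σ, hσ, fun x ρ hρ => Measure.AbsolutelyContinuous.mk fun A _ hA => ?_⟩
  have hGA : ∀ g ∈ G, g ∈ spectralNull hU A := by
    intro g hg τ hτ
    obtain ⟨τ', hτ'⟩ := exists_isSpectralMeasureOf hU (f - (c ⟨g, hg⟩ : ℂ) • g)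
    have h1 := (hτ.smul (c ⟨g, hg⟩ : ℂ)).add hτ' fun n => by
      rw [(hsplit ⟨g, hg⟩ n).1, (hsplit ⟨g, hg⟩ n).2, add_zero]
    rw [add_sub_cancel] at h1
    rw [hσ.unique h1, Measure.add_apply, add_eq_zero, Measure.smul_apply, smul_eq_mul,
      mul_eq_zero] at hA
    refine hA.1.resolve_left (ENNReal.ofReal_pos.2 ?_).ne'
    have := hcpos ⟨g, hg⟩
    exact pow_pos (norm_pos_iff.2 (Complex.ofReal_ne_zero.2 this.ne')) 2
  -- A unit vector orthogonal to this subspace would belong to `G` by maximality, hence to the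
  -- subspace itself.
  have htop : spectralNull hU A = ⊤ := by
    rw [← (spectralNull_isClosed hU A).submodule_topologicalClosure_eq,
      Submodule.topologicalClosure_eq_top_iff, Submodule.eq_bot_iff]
    intro y hy
    by_contra hne
    set u : H := ((‖y‖⁻¹ : ℝ) : ℂ) • y
    have hu : u ∈ (spectralNull hU A)ᗮ := Submodule.smul_mem _ _ hy
    have hu1 : ‖u‖ = 1 := by
      rw [norm_smul, Complex.norm_real, norm_inv, norm_norm,
        inv_mul_cancel₀ (norm_ne_zero_iff.2 hne)]
    have huG := hG3 u hu1 fun g hg =>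
      cyclicOrthogonal_of_mem_spectralNull_orthogonal hU (hGA g hg) hu
    have := Submodule.inner_right_of_mem_orthogonal (hGA u huG) hu
    rw [inner_self_eq_zero] at this
    simp [this] at hu1
  have hx : x ∈ spectralNull hU A := htop ▸ Submodule.mem_top
  exact hx ρ hρ

theorem WeakPowerLimit.monomialLimit {U : H →L[ℂ] H} (hU : U ∈ unitary (H →L[ℂ] H)) {k : ℕ → ℕ}
    {c : ℝ} (h : WeakPowerLimit U k c) (hk : Tendsto k atTop atTop) {f : H} {σ : Measure Circle}
    (hσ : IsSpectralMeasureOf U f σ) : MonomialLimit σ k c := by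
  have hcoef : ∀ n : ℕ, ∫ z, circleMonomial n z ∂σ = ⟪f, (U ^ n) f⟫_ℂ := fun n => by
    simpa only [circleMonomial_apply, zpow_natCast] using hσ.2 n
  intro j
  obtain ⟨l, rfl | rfl⟩ := j.eq_nat_or_neg
  · refine (h ((U ^ l) f) f).congr' (Eventually.of_forall fun i => ?_) |>.trans_eq ?_
    · rw [← Nat.cast_add, hcoef, pow_add, mul_apply_eq_comp]
    · rw [hcoef]
  -- For a negative shift, unitarity turns $\langle f,U^{k_i-l}f\rangle$ into $\langle
  -- U^lf,U^{k_i}f\rangle$ once $k_i\ge l$.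
  · refine (h f ((U ^ l) f)).congr' ?_ |>.trans_eq ?_
    · filter_upwards [hk.eventually_ge_atTop l] with i hi
      rw [← sub_eq_add_neg, ← Nat.cast_sub hi, hcoef, ← inner_unitary (pow_mem hU l) f,
        ← mul_apply_eq_comp, ← pow_add, Nat.add_sub_cancel' hi]
    · rw [integral_circleMonomial_neg, hcoef, inner_conj_symm]

end MaximalType

theorem spectrumSingularToPowers_of_weakPowerLimit {X : Type*} [MeasurableSpace X] {μ : Measure X}
    [SFinite μ] [MeasurableSpace.CountablyGenerated X]
    {T : X → X} {hT : MeasurePreserving T μ μ} (hU : koopman hT ∈ unitary (Lp ℂ 2 μ →L[ℂ] Lp ℂ 2 μ))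
    {k : ℕ → ℕ} {a : ℝ} (ha : 0 < a) (ha' : a < 1) (hk : Tendsto k atTop atTop)
    (h : WeakPowerLimit (koopman hT) k a) : SpectrumSingularToPowers hT := by
  -- Needed for separability of $L^2$, on which the maximal spectral vector depends.
  have : Fact ((2 : ℝ≥0∞) ≠ ∞) := ⟨ENNReal.ofNat_ne_top⟩
  obtain ⟨f, σ, hσ, hmax⟩ := exists_maximal_spectral_vector hU
  have := hσ.1
  refine ⟨σ, ⟨hσ.1, ⟨f, σ, hσ, Measure.AbsolutelyContinuous.rfl, Measure.AbsolutelyContinuous.rfl⟩,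
    hmax⟩, fun n hn => ?_⟩
  have := isFiniteMeasure_convPower σ n
  have hlim := h.monomialLimit hU hk hσ
  exact hlim.mutuallySingular (hlim.convPower n) (pow_lt_self_of_lt_one₀ ha ha' hn).ne'

/-- An isometry with a right inverse is unitary; composition with the inverse map is that right
inverse. -/
theorem koopman_mem_unitary {X : Type*} [MeasurableSpace X] {μ : Measure X} (T : X ≃ᵐ X)
    (hT : MeasurePreserving T μ μ) : koopman hT ∈ unitary (Lp ℂ 2 μ →L[ℂ] Lp ℂ 2 μ) := by
  have h1 : ContinuousLinearMap.adjoint (koopman hT) * koopman hT = 1 := by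
    ext1 f
    refine ext_inner_left ℂ fun g => ?_
    rw [mul_apply_eq_comp, ContinuousLinearMap.adjoint_inner_right]
    exact (Lp.compMeasurePreservingₗᵢ ℂ T hT).inner_map_map g f
  have h2 : koopman hT * koopman (hT.symm T) = 1 := by
    ext1 f
    have := Lp.compMeasurePreserving_comp_apply f (hT.symm T) hT
    change Lp.compMeasurePreserving T hT (Lp.compMeasurePreserving T.symm (hT.symm T) f) = f
    rw [← this]
    have e : T.symm ∘ T = id := by ext x; simp
    simp only [e, Lp.compMeasurePreserving_id_apply]
  have h3 : ContinuousLinearMap.adjoint (koopman hT) = koopman (hT.symm T) := by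
    rw [← mul_one (ContinuousLinearMap.adjoint _), ← h2, ← mul_assoc, h1, one_mul]
  rw [Unitary.mem_iff, ContinuousLinearMap.star_eq_adjoint]
  exact ⟨h1, h3 ▸ h2⟩

/-- The extension `F(T, p)` as a bimeasurable bijection. -/
def cyclicExtensionEquiv (T : ℝ ≃ᵐ ℝ) (p : ℕ) : ℝ × ZMod p ≃ᵐ ℝ × ZMod p where
  toFun := cyclicExtension T p
  invFun q := (if q.2 = 1 then T.symm q.1 else q.1, q.2 - 1)
  left_inv q := by
    by_cases h : q.2 = 0 <;> ext <;> simp [cyclicExtension, h]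
  right_inv q := by
    by_cases h : q.2 = 1 <;> ext <;> simp [cyclicExtension, h, sub_eq_zero]
  measurable_toFun := by
    refine Measurable.prodMk (Measurable.ite (measurable_snd (measurableSet_singleton 0))
      (T.measurable.comp measurable_fst) measurable_fst)
      ((measurable_from_top (f := fun z : ZMod p => z + 1)).comp measurable_snd)
  measurable_invFun := by
    refine Measurable.prodMk (Measurable.ite (measurable_snd (measurableSet_singleton 1))
      (T.symm.measurable.comp measurable_fst) measurable_fst)
      ((measurable_from_top (f := fun z : ZMod p => z - 1)).comp measurable_snd)

theorem cyclicExtension_properties (T : ℝ ≃ᵐ ℝ) (hT : MeasurePreserving T volume volume)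
    (h : HasMixedLimits hT) (p : ℕ) (hp : 1 < p) :
    SpectrumSingularToPowers (cyclicExtension_measurePreserving hT p hp) ∧
      NoIntertwiningWithPowers (cyclicExtension_measurePreserving hT p hp) := by
  obtain ⟨a, m, n, ha, ha', hm, -, hweak, -⟩ := h
  have : NeZero p := ⟨by omega⟩
  have hS := hweak.cyclicExtension p hp
  exact ⟨spectrumSingularToPowers_of_weakPowerLimit
    (koopman_mem_unitary (cyclicExtensionEquiv T p) (cyclicExtension_measurePreserving hT p hp))
    ha ha' (hm.const_mul_atTop' (by omega)) hS,
    noIntertwiningWithPowers_of_weakPowerLimit ha ha' hS⟩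

/-! ### A rank-one transformation of the line -/

namespace RankOne

/-- The number of columns into which the `j`-th tower is cut. -/
def cuts (j : ℕ) : ℕ := if Even j then 2 else j + 1

/-- The height of the `j`-th tower: the columns are stacked, with `height j` spacers below and
above. -/
def height : ℕ → ℕ
  | 0 => 1
  | j + 1 => (cuts j + 2) * height j

/-- The width of the levels of the `j`-th tower. -/
def width : ℕ → ℝ
  | 0 => 1
  | j + 1 => width j / cuts j

/-- The `j`-th tower fills the interval `[-margin j, margin j + 1)`. -/
def margin : ℕ → ℝ
  | 0 => 0
  | j + 1 => margin j + height j * width (j + 1)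

/-- The left end point of a level. -/
def base : ℕ → ℕ → ℝ
  | 0, _ => 0
  | j + 1, L =>
    -- `L / height j` is the column and `L % height j` the row. Column `0` consists of spacers left
    -- of the old interval, columns `1` to `cuts j` of slices of the old levels, and the last column
    -- of spacers on the right.
    if L / height j = 0 then -margin (j + 1) + (L % height j : ℕ) * width (j + 1)
    else if L / height j ≤ cuts j then
      base j (L % height j) + ((L / height j : ℕ) - 1) * width (j + 1)
    else margin j + 1 + (L % height j : ℕ) * width (j + 1)

/-- The levels of the towers. -/
def level (j l : ℕ) : Set ℝ := Set.Ico (base j l) (base j l + width j)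

/-! ### Sizes of the towers -/

theorem two_le_cuts (j : ℕ) : 2 ≤ cuts j := by
  unfold cuts
  split_ifs with h
  · exact le_rfl
  · have : j ≠ 0 := fun h0 => h (h0 ▸ Even.zero)
    omega

theorem cuts_pos (j : ℕ) : (0 : ℝ) < cuts j := by
  have := two_le_cuts j
  exact_mod_cast (by omega : 0 < cuts j)

theorem height_pos (j : ℕ) : 0 < height j := by
  induction j with
  | zero => exact one_pos
  | succ j ih => exact Nat.mul_pos (by omega) ih

theorem width_pos (j : ℕ) : 0 < width j := by
  induction j with
  | zero => exact one_pos
  | succ j ih => exact div_pos ih (cuts_pos j)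

theorem cuts_mul_width (j : ℕ) : cuts j * width (j + 1) = width j := by
  rw [width, mul_div_cancel₀ _ (cuts_pos j).ne']

theorem width_le (j : ℕ) : width j ≤ (1 / 2) ^ j := by
  induction j with
  | zero => exact le_rfl
  | succ j ih =>
    have h2 : (2 : ℝ) ≤ cuts j := by exact_mod_cast two_le_cuts j
    have := cuts_mul_width j
    have := width_pos (j + 1)
    rw [pow_succ]
    nlinarith

theorem margin_mono : Monotone margin := monotone_nat_of_le_succ fun j => by
  have := width_pos (j + 1)
  rw [margin]
  have : (0 : ℝ) ≤ height j * width (j + 1) := by positivity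
  linarith

theorem one_le_height_mul_width (j : ℕ) : 1 ≤ height j * width j := by
  induction j with
  | zero => simp [height, width]
  | succ j ih =>
    have h : (height (j + 1) : ℝ) * width (j + 1) =
        height j * width j + 2 * (height j * width (j + 1)) := by
      rw [← cuts_mul_width j, height]; push_cast; ring
    have := width_pos (j + 1)
    have : (0 : ℝ) ≤ height j * width (j + 1) := by positivity
    linarith

/-- At an even stage `cuts` is `2`, so each side gains half the total length of the tower, which is
at least `1 / 2`. Hence the towers exhaust the line. -/
theorem le_margin (i : ℕ) : (i : ℝ) / 2 ≤ margin (2 * i) := by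
  induction i with
  | zero => simp [margin]
  | succ i ih =>
    have h1 : margin (2 * i + 1) ≤ margin (2 * (i + 1)) := margin_mono (by omega)
    have h2 : cuts (2 * i) = 2 := by simp [cuts]
    have h3 := cuts_mul_width (2 * i)
    have h4 := one_le_height_mul_width (2 * i)
    rw [margin] at h1
    rw [h2] at h3
    push_cast at *
    rw [← h3] at h4
    linarith

/-! ### Levels tile the interval of their tower -/

theorem base_bottom {j l : ℕ} (hl : l < height j) :
    base (j + 1) l = -margin (j + 1) + l * width (j + 1) := by
  rw [base, Nat.div_eq_of_lt hl, Nat.mod_eq_of_lt hl, if_pos rfl]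

theorem base_copy {j l d : ℕ} (hl : l < height j) (hd : 1 ≤ d) (hd' : d ≤ cuts j) :
    base (j + 1) (l + d * height j) = base j l + ((d : ℝ) - 1) * width (j + 1) := by
  rw [base, Nat.add_mul_div_right _ _ (height_pos j), Nat.div_eq_of_lt hl,
    Nat.add_mul_mod_self_right, Nat.mod_eq_of_lt hl, zero_add, if_neg (by omega), if_pos hd']

theorem base_top {j l : ℕ} (hl : l < height j) :
    base (j + 1) (l + (cuts j + 1) * height j) = margin j + 1 + l * width (j + 1) := by
  rw [base, Nat.add_mul_div_right _ _ (height_pos j), Nat.div_eq_of_lt hl,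
    Nat.add_mul_mod_self_right, Nat.mod_eq_of_lt hl, zero_add, if_neg (by omega),
    if_neg (by omega)]

theorem exists_column {j L : ℕ} (hL : L < height (j + 1)) :
    ∃ d l, d ≤ cuts j + 1 ∧ l < height j ∧ L = l + d * height j := by
  refine ⟨L / height j, L % height j, ?_, Nat.mod_lt _ (height_pos j), ?_⟩
  · have : L / height j < cuts j + 2 := Nat.div_lt_of_lt_mul (by rw [mul_comm]; exact hL)
    omega
  · rw [mul_comm, Nat.mod_add_div]

theorem column_lt {j l d : ℕ} (hl : l < height j) (hd : d ≤ cuts j + 1) :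
    l + d * height j < height (j + 1) := by
  calc l + d * height j < height j + d * height j := by omega
    _ = (d + 1) * height j := by ring
    _ ≤ (cuts j + 2) * height j := Nat.mul_le_mul_right _ (by omega)

theorem level_copy_subset {j l d : ℕ} (hl : l < height j) (hd : 1 ≤ d) (hd' : d ≤ cuts j) :
    level (j + 1) (l + d * height j) ⊆ level j l := by
  have h1 : (1 : ℝ) ≤ d := by exact_mod_cast hd
  have h2 : (d : ℝ) ≤ cuts j := by exact_mod_cast hd'
  have h3 := cuts_mul_width j
  have h4 := width_pos (j + 1)
  unfold level
  rw [base_copy hl hd hd', ← h3]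
  refine Set.Ico_subset_Ico ?_ ?_ <;> nlinarith

theorem level_bottom_subset {j l : ℕ} (hl : l < height j) :
    level (j + 1) l ⊆ Set.Ico (-margin (j + 1)) (-margin j) := by
  have h1 : (l : ℝ) + 1 ≤ height j := by exact_mod_cast hl
  have h4 := width_pos (j + 1)
  unfold level
  rw [base_bottom hl, margin]
  refine Set.Ico_subset_Ico ?_ ?_
  · have : 0 ≤ (l : ℝ) * width (j + 1) := by positivity
    linarith
  · nlinarith

theorem level_top_subset {j l : ℕ} (hl : l < height j) :
    level (j + 1) (l + (cuts j + 1) * height j) ⊆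
      Set.Ico (margin j + 1) (margin (j + 1) + 1) := by
  have h1 : (l : ℝ) + 1 ≤ height j := by exact_mod_cast hl
  have h4 := width_pos (j + 1)
  unfold level
  rw [base_top hl, margin]
  refine Set.Ico_subset_Ico ?_ ?_
  · have : 0 ≤ (l : ℝ) * width (j + 1) := by positivity
    linarith
  · nlinarith

theorem level_subset {j l : ℕ} (hl : l < height j) :
    level j l ⊆ Set.Ico (-margin j) (margin j + 1) := by
  induction j generalizing l with
  | zero => simp [level, base, margin, width]
  | succ j ih =>
    obtain ⟨d, k, hd, hk, rfl⟩ := exists_column hl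
    have hm := margin_mono (Nat.le_add_right j 1)
    rcases Nat.eq_zero_or_pos d with rfl | hd0
    · rw [zero_mul, add_zero]
      exact (level_bottom_subset hk).trans (Set.Ico_subset_Ico le_rfl
        (by have : 0 ≤ margin (j + 1) := margin_mono (Nat.zero_le _)
            have : 0 ≤ margin j := margin_mono (Nat.zero_le _)
            linarith))
    · rcases hd.lt_or_eq with hd | rfl
      · exact (level_copy_subset hk hd0 (by omega)).trans
          ((ih hk).trans (Set.Ico_subset_Ico (by linarith) (by linarith)))
      · exact (level_top_subset hk).trans (Set.Ico_subset_Ico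
          (by have : 0 ≤ margin (j + 1) := margin_mono (Nat.zero_le _)
              have : 0 ≤ margin j := margin_mono (Nat.zero_le _)
              linarith) le_rfl)

theorem exists_mul_le_lt {w y : ℝ} (hw : 0 < w) (hy : 0 ≤ y) {n : ℕ} (hn : y < n * w) :
    ∃ k < n, k * w ≤ y ∧ y < k * w + w := by
  refine ⟨⌊y / w⌋₊, ?_, ?_, ?_⟩
  · exact (Nat.floor_lt (div_nonneg hy hw.le)).2 ((div_lt_iff₀ hw).2 hn)
  · exact (le_div_iff₀ hw).1 (Nat.floor_le (div_nonneg hy hw.le))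
  · have := (div_lt_iff₀ hw).1 (Nat.lt_floor_add_one (y / w))
    linarith

theorem eq_of_mul_le_lt {w y : ℝ} (hw : 0 < w) {k k' : ℕ} (h1 : k * w ≤ y)
    (h2 : y < k * w + w) (h1' : k' * w ≤ y) (h2' : y < k' * w + w) : k = k' := by
  have h3 : (k : ℝ) < k' + 1 := by nlinarith
  have h4 : (k' : ℝ) < k + 1 := by nlinarith
  have h3' : k < k' + 1 := by exact_mod_cast h3
  have h4' : k' < k + 1 := by exact_mod_cast h4
  omega

/-- Each level is cut into the corresponding levels of the columns of the next tower. -/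
theorem exists_level_copy {j l : ℕ} (hl : l < height j) {x : ℝ} (hx : x ∈ level j l) :
    ∃ d, 1 ≤ d ∧ d ≤ cuts j ∧ x ∈ level (j + 1) (l + d * height j) := by
  obtain ⟨hx1, hx2⟩ := hx
  obtain ⟨k, hk, hk1, hk2⟩ := exists_mul_le_lt (width_pos (j + 1)) (y := x - base j l)
    (n := cuts j) (by linarith) (by rw [cuts_mul_width]; linarith)
  refine ⟨k + 1, by omega, hk, ?_⟩
  rw [level, base_copy hl (by omega) hk]
  push_cast
  constructor <;> linarith

theorem exists_level {j : ℕ} {x : ℝ} (hx : x ∈ Set.Ico (-margin j) (margin j + 1)) :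
    ∃ l < height j, x ∈ level j l := by
  induction j with
  | zero => exact ⟨0, one_pos, by simpa [level, base, margin, width] using hx⟩
  | succ j ih =>
    obtain ⟨hx1, hx2⟩ := hx
    have hm : margin (j + 1) = margin j + height j * width (j + 1) := rfl
    rcases lt_or_ge x (-margin j) with h1 | h1
    · obtain ⟨k, hk, hk1, hk2⟩ := exists_mul_le_lt (width_pos (j + 1)) (y := x + margin (j + 1))
        (n := height j) (by linarith) (by linarith)
      refine ⟨k, (by simpa using column_lt hk (Nat.zero_le _)), ?_⟩
      rw [level, base_bottom hk]
      constructor <;> linarith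
    · rcases lt_or_ge x (margin j + 1) with h2 | h2
      · obtain ⟨l, hl, hxl⟩ := ih ⟨h1, h2⟩
        obtain ⟨d, _, hd2, hxd⟩ := exists_level_copy hl hxl
        exact ⟨_, column_lt hl (by omega), hxd⟩
      · obtain ⟨k, hk, hk1, hk2⟩ := exists_mul_le_lt (width_pos (j + 1)) (y := x - (margin j + 1))
          (n := height j) (by linarith) (by linarith)
        refine ⟨k + (cuts j + 1) * height j, column_lt hk le_rfl, ?_⟩
        rw [level, base_top hk]
        constructor <;> linarith

theorem level_injective {j L L' : ℕ} (hL : L < height j) (hL' : L' < height j) {x : ℝ}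
    (hx : x ∈ level j L) (hx' : x ∈ level j L') : L = L' := by
  induction j generalizing L L' with
  | zero => simp only [height] at hL hL'; omega
  | succ j ih =>
    obtain ⟨d, l, hd, hl, rfl⟩ := exists_column hL
    obtain ⟨d', l', hd', hl', rfl⟩ := exists_column hL'
    have hm0 : 0 ≤ margin j := margin_mono (Nat.zero_le _)
    have hw := width_pos (j + 1)
    -- The position of `x` relative to the old interval decides between lower spacers, slices and
    -- upper spacers.
    have trich : ∀ {d l}, d ≤ cuts j + 1 → l < height j → x ∈ level (j + 1) (l + d * height j) →
        (x < -margin j ∧ d = 0) ∨ (-margin j ≤ x ∧ x < margin j + 1 ∧ 1 ≤ d ∧ d ≤ cuts j) ∨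
          (margin j + 1 ≤ x ∧ d = cuts j + 1) := by
      intro d l hd hl hx
      rcases Nat.eq_zero_or_pos d with rfl | hd0
      · rw [zero_mul, add_zero] at hx
        exact Or.inl ⟨(level_bottom_subset hl hx).2, rfl⟩
      · rcases hd.lt_or_eq with hd | rfl
        · have := level_subset hl (level_copy_subset hl hd0 (by omega) hx)
          exact Or.inr (Or.inl ⟨this.1, this.2, hd0, by omega⟩)
        · exact Or.inr (Or.inr ⟨(level_top_subset hl hx).1, rfl⟩)
    rcases trich hd hl hx with ⟨h1, rfl⟩ | ⟨h1, h2, h3, h4⟩ | ⟨h1, rfl⟩ <;>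
      rcases trich hd' hl' hx' with ⟨h1', rfl⟩ | ⟨h1', h2', h3', h4'⟩ | ⟨h1', rfl⟩ <;>
      try (exfalso; linarith)
    · rw [zero_mul, add_zero, level, base_bottom hl] at hx
      rw [zero_mul, add_zero, level, base_bottom hl'] at hx'
      exact congrArg (· + 0 * height j) (eq_of_mul_le_lt hw (y := x + margin (j + 1))
        (by linarith [hx.1]) (by linarith [hx.2])
        (by linarith [hx'.1]) (by linarith [hx'.2]))
    · obtain rfl := ih hl hl' (level_copy_subset hl h3 h4 hx) (level_copy_subset hl' h3' h4' hx')
      rw [level, base_copy hl h3 h4] at hx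
      rw [level, base_copy hl h3' h4'] at hx'
      -- One width is added because slice `d` starts `d - 1` widths into the old level.
      exact congrArg (l + · * height j) (eq_of_mul_le_lt hw (y := x - base j l + width (j + 1))
        (by linarith [hx.1])
        (by linarith [hx.2]) (by linarith [hx'.1]) (by linarith [hx'.2]))
    · rw [level, base_top hl] at hx
      rw [level, base_top hl'] at hx'
      exact congrArg (· + (cuts j + 1) * height j) (eq_of_mul_le_lt hw (y := x - (margin j + 1))
        (by linarith [hx.1]) (by linarith [hx.2])
        (by linarith [hx'.1]) (by linarith [hx'.2]))

/-- The levels of two towers are nested or disjoint. -/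
theorem level_subset_level {i j l l' : ℕ} (hij : i ≤ j) (hl : l < height i) (hl' : l' < height j)
    {x : ℝ} (hx : x ∈ level i l) (hx' : x ∈ level j l') : level j l' ⊆ level i l := by
  induction j, hij using Nat.le_induction generalizing l' with
  | base => rw [level_injective hl hl' hx hx']
  | succ j hij ih =>
    have hm := margin_mono hij
    obtain ⟨k, hk, hxk⟩ := exists_level (j := j) (x := x)
      ⟨by linarith [(level_subset hl hx).1], by linarith [(level_subset hl hx).2]⟩
    obtain ⟨d, hd, hd', hxd⟩ := exists_level_copy hk hxk
    rw [level_injective hl' (column_lt hk (by omega)) hx' hxd]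
    exact (level_copy_subset hk hd hd').trans (ih hk hxk)

theorem exists_mem_range (x : ℝ) : ∃ j, ∀ k ≥ j, x ∈ Set.Ico (-margin k) (margin k + 1) := by
  obtain ⟨i, hi⟩ := exists_nat_gt (2 * |x|)
  refine ⟨2 * i, fun k hk => ?_⟩
  have h1 := le_margin i
  have h2 := margin_mono hk
  have h3 := neg_abs_le x
  have h4 := le_abs_self x
  constructor <;> linarith

/-! ### The transformation as the union of the one-step maps -/

/-- One step up in the `j`-th tower. -/
def Step (j : ℕ) (x y : ℝ) : Prop :=
  ∃ l, l + 1 < height j ∧ x ∈ level j l ∧ y = x - base j l + base j (l + 1)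

theorem add_mem_level {j l l' : ℕ} {x : ℝ} (hx : x ∈ level j l) :
    x - base j l + base j l' ∈ level j l' := by
  obtain ⟨h1, h2⟩ := hx
  constructor <;> linarith

/-- Consecutive levels are sliced alike, so translating one onto the other carries slice `d` to
slice `d`. This coherence makes the union of the one-step maps a function. -/
theorem Step.succ {j : ℕ} {x y : ℝ} (h : Step j x y) : Step (j + 1) x y := by
  obtain ⟨l, hl, hx, rfl⟩ := h
  obtain ⟨d, hd, hd', hxd⟩ := exists_level_copy (by omega) hx
  have e : l + d * height j + 1 = (l + 1) + d * height j := by ring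
  refine ⟨l + d * height j, ?_, hxd, ?_⟩
  · rw [e]; exact column_lt hl (by omega)
  · rw [e, base_copy (by omega) hd hd', base_copy hl hd hd']
    ring

theorem Step.mono {i j : ℕ} (hij : i ≤ j) {x y : ℝ} (h : Step i x y) : Step j x y := by
  induction j, hij using Nat.le_induction with
  | base => exact h
  | succ j _ ih => exact ih.succ

theorem Step.unique {i j : ℕ} {x y y' : ℝ} (h : Step i x y) (h' : Step j x y') : y = y' := by
  obtain ⟨l, hl, hx, rfl⟩ := h.mono (le_max_left i j)
  obtain ⟨l', hl', hx', rfl⟩ := h'.mono (le_max_right i j)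
  rw [level_injective (by omega) (by omega) hx hx']

theorem Step.injective {i j : ℕ} {x x' y : ℝ} (h : Step i x y) (h' : Step j x' y) : x = x' := by
  obtain ⟨l, hl, hx, hy⟩ := h.mono (le_max_left i j)
  obtain ⟨l', hl', hx', hy'⟩ := h'.mono (le_max_right i j)
  have e := level_injective hl hl' (hy ▸ add_mem_level hx) (hy' ▸ add_mem_level hx')
  obtain rfl : l = l' := by omega
  linarith

/-- Even a point of a top level gets a successor one stage later: its slice lies in one of columns
`1` to `cuts j`, and a whole column lies above. -/
theorem exists_step (x : ℝ) : ∃ y j, Step j x y := by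
  obtain ⟨j, hj⟩ := exists_mem_range x
  obtain ⟨l, hl, hx⟩ := exists_level (hj j le_rfl)
  obtain ⟨d, hd, hd', hxd⟩ := exists_level_copy hl hx
  have : l + d * height j + 1 < height (j + 1) := by
    have h1 : l + (d + 1) * height j < height (j + 1) := column_lt hl (by omega)
    have h2 := two_le_cuts j
    have h3 := column_lt (j := j) hl (show cuts j + 1 ≤ cuts j + 1 from le_rfl)
    have h4 : (d + 1) * height j = d * height j + height j := by ring
    have h5 := height_pos j
    omega
  exact ⟨_, j + 1, _, this, hxd, rfl⟩

/-- One stage later a full column of spacers lies below the point. Arbitrarily late stages are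
allowed so that the level can be made short. -/
theorem exists_pos_level (x : ℝ) (j₀ : ℕ) :
    ∃ j l, j₀ ≤ j ∧ 0 < l ∧ l < height j ∧ x ∈ level j l := by
  obtain ⟨j₁, hj⟩ := exists_mem_range x
  obtain ⟨l, hl, hx⟩ := exists_level (hj (max j₀ j₁) (le_max_right _ _))
  obtain ⟨d, hd, hd', hxd⟩ := exists_level_copy hl hx
  refine ⟨max j₀ j₁ + 1, _, (le_max_left _ _).trans (Nat.le_succ _), ?_,
    column_lt hl (by omega), hxd⟩
  exact Nat.add_pos_right _ (Nat.mul_pos hd (height_pos _))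

theorem exists_step_symm (y : ℝ) : ∃ x j, Step j x y := by
  obtain ⟨j, l, -, hl0, hl, hy⟩ := exists_pos_level y 0
  obtain ⟨k, rfl⟩ := Nat.exists_eq_succ_of_ne_zero hl0.ne'
  exact ⟨y - base j (k + 1) + base j k, j, k, hl, add_mem_level hy, by ring⟩

/-- The union of the one-step maps. -/
def shift (x : ℝ) : ℝ := (exists_step x).choose

/-- The inverse of `shift`. -/
def unshift (y : ℝ) : ℝ := (exists_step_symm y).choose

theorem shift_eq_iff {x y : ℝ} : shift x = y ↔ ∃ j, Step j x y := by
  obtain ⟨j, hj⟩ := (exists_step x).choose_spec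
  exact ⟨fun h => ⟨j, h ▸ hj⟩, fun ⟨k, hk⟩ => hj.unique hk⟩

theorem unshift_eq_iff {x y : ℝ} : unshift y = x ↔ ∃ j, Step j x y := by
  obtain ⟨j, hj⟩ := (exists_step_symm y).choose_spec
  exact ⟨fun h => ⟨j, h ▸ hj⟩, fun ⟨k, hk⟩ => hj.injective hk⟩

theorem measurableSet_level (j l : ℕ) : MeasurableSet (level j l) := measurableSet_Ico

theorem shift_preimage (B : Set ℝ) : shift ⁻¹' B = ⋃ (j : ℕ) (l : ℕ) (_ : l + 1 < height j),
    level j l ∩ (fun x => x - base j l + base j (l + 1)) ⁻¹' B := by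
  ext x
  simp only [Set.mem_preimage, Set.mem_iUnion, Set.mem_inter_iff, exists_prop]
  constructor
  · intro hx
    obtain ⟨j, l, hl, hxl, e⟩ := shift_eq_iff.1 (rfl : shift x = shift x)
    exact ⟨j, l, hl, hxl, e ▸ hx⟩
  · rintro ⟨j, l, hl, hxl, hB⟩
    rwa [shift_eq_iff.2 ⟨j, l, hl, hxl, rfl⟩]

theorem unshift_preimage (B : Set ℝ) : unshift ⁻¹' B = ⋃ (j : ℕ) (l : ℕ) (_ : l + 1 < height j),
    level j (l + 1) ∩ (fun y => y - base j (l + 1) + base j l) ⁻¹' B := by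
  ext y
  simp only [Set.mem_preimage, Set.mem_iUnion, Set.mem_inter_iff, exists_prop]
  constructor
  · intro hy
    obtain ⟨j, l, hl, hxl, e⟩ := unshift_eq_iff.1 (rfl : unshift y = unshift y)
    refine ⟨j, l, hl, e ▸ add_mem_level hxl, ?_⟩
    rwa [show y - base j (l + 1) + base j l = unshift y by linarith]
  · rintro ⟨j, l, hl, hyl, hB⟩
    rwa [unshift_eq_iff.2 ⟨j, l, hl, add_mem_level hyl, by ring⟩]

/-- The rank-one transformation as a bimeasurable bijection of the line. -/
def shiftEquiv : ℝ ≃ᵐ ℝ where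
  toFun := shift
  invFun := unshift
  left_inv _ := unshift_eq_iff.2 (shift_eq_iff.1 rfl)
  right_inv _ := shift_eq_iff.2 (unshift_eq_iff.1 rfl)
  measurable_toFun B hB := by
    change MeasurableSet (shift ⁻¹' B)
    rw [shift_preimage]
    exact MeasurableSet.iUnion fun j => MeasurableSet.iUnion fun l => MeasurableSet.iUnion fun _ =>
      (measurableSet_level j l).inter (hB.preimage (by fun_prop))
  measurable_invFun B hB := by
    change MeasurableSet (unshift ⁻¹' B)
    rw [unshift_preimage]
    exact MeasurableSet.iUnion fun j => MeasurableSet.iUnion fun l => MeasurableSet.iUnion fun _ =>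
      (measurableSet_level j (l + 1)).inter (hB.preimage (by fun_prop))

theorem shift_preimage_level {j l : ℕ} (hl : l + 1 < height j) :
    shift ⁻¹' level j (l + 1) = level j l := by
  ext x
  constructor
  · intro hx
    have h1 : Step j (shift x - base j (l + 1) + base j l) (shift x) :=
      ⟨l, hl, add_mem_level hx, by ring⟩
    obtain ⟨k, hk⟩ := shift_eq_iff.1 (rfl : shift x = shift x)
    rw [hk.injective h1]
    exact add_mem_level hx
  · intro hx
    rw [Set.mem_preimage, shift_eq_iff.2 ⟨j, l, hl, hx, rfl⟩]
    exact add_mem_level hx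

theorem shift_iterate_mem {j l k : ℕ} (hl : l + k < height j) {x : ℝ} (hx : x ∈ level j l) :
    shift^[k] x ∈ level j (l + k) := by
  induction k with
  | zero => exact hx
  | succ k ih =>
    rw [Function.iterate_succ_apply']
    have := ih (by omega)
    rwa [← shift_preimage_level (j := j) (l := l + k) (by omega)] at this

/-! ### Levels as a generating π-system; invariance of Lebesgue measure -/

theorem volume_level (j l : ℕ) : volume (level j l) = ENNReal.ofReal (width j) := by
  rw [level, Real.volume_Ico, add_sub_cancel_left]

theorem volume_real_level (j l : ℕ) : volume.real (level j l) = width j := by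
  rw [Measure.real, volume_level, ENNReal.toReal_ofReal (width_pos j).le]

/-- The levels other than the bottom levels. -/
def levels : Set (Set ℝ) := {A | ∃ j l, 0 < l ∧ l < height j ∧ A = level j l}

/-- Two intersecting levels are nested, so their intersection is one of them. Bottom levels are left
out because the preimage of every other level is the level beneath it. -/
theorem isPiSystem_levels : IsPiSystem levels := by
  rintro _ ⟨j, l, hl0, hl, rfl⟩ _ ⟨j', l', hl0', hl', rfl⟩ ⟨x, hx, hx'⟩
  rcases le_total j j' with h | h
  · rw [Set.inter_eq_self_of_subset_right (level_subset_level h hl hl' hx hx')]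
    exact ⟨j', l', hl0', hl', rfl⟩
  · rw [Set.inter_eq_self_of_subset_left (level_subset_level h hl' hl hx' hx)]
    exact ⟨j, l, hl0, hl, rfl⟩

theorem countable_levels : levels.Countable := by
  refine (Set.countable_range fun q : ℕ × ℕ => level q.1 q.2).mono ?_
  rintro _ ⟨j, l, -, -, rfl⟩
  exact ⟨(j, l), rfl⟩

theorem generateFrom_levels : (inferInstance : MeasurableSpace ℝ) =
    MeasurableSpace.generateFrom levels := by
  refine le_antisymm ?_ (MeasurableSpace.generateFrom_le ?_)
  · rw [show (inferInstance : MeasurableSpace ℝ) = borel ℝ from BorelSpace.measurable_eq, borel]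
    refine MeasurableSpace.generateFrom_le fun U hU => ?_
    have hU : IsOpen U := hU
    -- Widths tend to zero, so each point of an open set has a level around it inside the set; there
    -- are only countably many levels.
    have hU' : U = ⋃₀ {A ∈ levels | A ⊆ U} := by
      refine subset_antisymm (fun x hx => ?_) (Set.sUnion_subset fun A hA => hA.2)
      obtain ⟨ε, hε, hball⟩ := Metric.isOpen_iff.1 hU x hx
      obtain ⟨n, hn⟩ := exists_pow_lt_of_lt_one hε (show (1 / 2 : ℝ) < 1 by norm_num)
      obtain ⟨j, l, hj, hl0, hl, hxl⟩ := exists_pos_level x n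
      refine ⟨level j l, ⟨⟨j, l, hl0, hl, rfl⟩, fun y hy => hball ?_⟩, hxl⟩
      have h1 : width j < ε := (width_le j).trans_lt
        ((pow_le_pow_of_le_one (by norm_num) (by norm_num) hj).trans_lt hn)
      rw [Metric.mem_ball, Real.dist_eq, abs_lt]
      constructor <;> linarith [hy.1, hy.2, hxl.1, hxl.2]
    rw [hU']
    exact MeasurableSet.sUnion (countable_levels.mono fun A hA => hA.1) fun A hA =>
      MeasurableSpace.measurableSet_generateFrom hA.1
  · rintro _ ⟨j, l, -, -, rfl⟩
    exact measurableSet_level j l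

theorem exists_levels_cover : ∃ S : ℕ → Set ℝ, (∀ n, S n ∈ levels) ∧ ⋃ n, S n = Set.univ := by
  obtain ⟨j, l, -, hl0, hl, -⟩ := exists_pos_level 0 0
  obtain ⟨S, hS⟩ := countable_levels.exists_eq_range ⟨_, j, l, hl0, hl, rfl⟩
  refine ⟨S, fun n => hS ▸ Set.mem_range_self n, Set.eq_univ_of_forall fun x => ?_⟩
  obtain ⟨j, l, -, hl0, hl, hx⟩ := exists_pos_level x 0
  have : level j l ∈ Set.range S := hS ▸ ⟨j, l, hl0, hl, rfl⟩
  obtain ⟨n, hn⟩ := this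
  exact Set.mem_iUnion.2 ⟨n, hn ▸ hx⟩

theorem volume_levels_ne_top {A : Set ℝ} (hA : A ∈ levels) : volume A ≠ ∞ := by
  obtain ⟨j, l, -, -, rfl⟩ := hA
  rw [volume_level]
  exact ENNReal.ofReal_ne_top

theorem measurePreserving_shift : MeasurePreserving shiftEquiv volume volume := by
  refine ⟨shiftEquiv.measurable, ?_⟩
  obtain ⟨S, hS, hcov⟩ := exists_levels_cover
  symm
  refine Measure.ext_of_generateFrom_of_iUnion levels S generateFrom_levels isPiSystem_levels hcov
    hS (fun n => volume_levels_ne_top (hS n)) ?_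
  rintro _ ⟨j, l, hl0, hl, rfl⟩
  obtain ⟨k, rfl⟩ := Nat.exists_eq_succ_of_ne_zero hl0.ne'
  rw [Measure.map_apply shiftEquiv.measurable (measurableSet_level _ _)]
  change _ = volume (shift ⁻¹' _)
  rw [shift_preimage_level hl, volume_level, volume_level]

/-! ### Weak limits along the heights -/

theorem measureReal_inter_level {j l : ℕ} (hl : l < height j) {s : Set ℝ} (hs : MeasurableSet s) :
    volume.real (s ∩ level j l) =
      ∑ d ∈ Finset.Icc 1 (cuts j), volume.real (s ∩ level (j + 1) (l + d * height j)) := by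
  have h1 : s ∩ level j l =
      ⋃ d ∈ Finset.Icc 1 (cuts j), s ∩ level (j + 1) (l + d * height j) := by
    ext x
    simp only [Set.mem_inter_iff, Set.mem_iUnion, Finset.mem_Icc, exists_prop]
    constructor
    · rintro ⟨hs, hx⟩
      obtain ⟨d, hd, hd', hxd⟩ := exists_level_copy hl hx
      exact ⟨d, ⟨hd, hd'⟩, hs, hxd⟩
    · rintro ⟨d, ⟨hd, hd'⟩, hs, hxd⟩
      exact ⟨hs, level_copy_subset hl hd hd' hxd⟩
  rw [h1]
  refine measureReal_biUnion_finset ?_ (fun d _ => hs.inter (measurableSet_level _ _)) fun d _ => ?_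
  · intro d hd d' hd' hne
    rw [Finset.coe_Icc, Set.mem_Icc] at hd hd'
    refine Set.disjoint_left.2 fun x hx hx' => hne ?_
    have := level_injective (column_lt hl (by omega)) (column_lt hl (by omega)) hx.2 hx'.2
    exact Nat.eq_of_mul_eq_mul_right (height_pos j) (by omega)
  · exact ((measure_mono Set.inter_subset_right).trans_lt
      (by rw [volume_level]; exact ENNReal.ofReal_lt_top)).ne

/-- A proportion holding on all levels of a fine tower is summed over slices to reach those of
coarser towers. -/
theorem measureReal_inter_level_descend {i j : ℕ} (hij : i ≤ j) {s t : Set ℝ}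
    (hs : MeasurableSet s) (ht : MeasurableSet t) {c : ℝ}
    (h : ∀ l < height j, volume.real (s ∩ level j l) = c * volume.real (t ∩ level j l)) :
    ∀ l < height i, volume.real (s ∩ level i l) = c * volume.real (t ∩ level i l) := by
  induction j, hij using Nat.le_induction with
  | base => exact h
  | succ j hij ih =>
    refine ih fun l hl => ?_
    rw [measureReal_inter_level hl hs, measureReal_inter_level hl ht, Finset.mul_sum]
    refine Finset.sum_congr rfl fun d hd => h _ (column_lt hl ?_)
    rw [Finset.mem_Icc] at hd
    omega

/-- Applying the map `height j` times keeps the row and advances one column. Of the `cuts j` slices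
of a level all but the last return to that level; the last goes to the upper spacers, outside every
earlier tower. -/
theorem measureReal_shift_preimage {i j l l' : ℕ} (hij : i ≤ j) (hl : l < height i)
    (hl' : l' < height j) :
    volume.real (shift^[height j] ⁻¹' level i l ∩ level j l') =
      (1 - (cuts j : ℝ)⁻¹) * volume.real (level i l ∩ level j l') := by
  have hms : MeasurableSet (shift^[height j] ⁻¹' level i l) :=
    (measurePreserving_shift.iterate (height j)).measurable (measurableSet_level i l)
  have hlt : ∀ d, d ≤ cuts j → l' + d * height j + height j < height (j + 1) := fun d hd => by
    have := column_lt hl' (show d + 1 ≤ cuts j + 1 by omega)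
    rwa [add_mul, one_mul, ← add_assoc] at this
  have hmem : ∀ d, d ≤ cuts j → ∀ x ∈ level (j + 1) (l' + d * height j),
      shift^[height j] x ∈ level (j + 1) (l' + (d + 1) * height j) := fun d hd x hx => by
    have := shift_iterate_mem (hlt d hd) hx
    rwa [add_assoc, ← Nat.succ_mul] at this
  have hout : ∀ x ∈ level (j + 1) (l' + cuts j * height j), shift^[height j] x ∉ level i l := by
    intro x hx hx'
    have h1 := level_top_subset hl' (hmem _ le_rfl x hx)
    have h2 := level_subset hl hx'
    linarith [h1.1, h2.2, margin_mono hij]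
  rw [measureReal_inter_level hl' hms]
  -- The two levels are nested or disjoint; in the disjoint case both sides vanish.
  by_cases hsub : ∃ x, x ∈ level i l ∧ x ∈ level j l'
  · obtain ⟨x, hx, hx'⟩ := hsub
    have hss := level_subset_level hij hl hl' hx hx'
    have hterm : ∀ d ∈ Finset.Icc 1 (cuts j),
        volume.real (shift^[height j] ⁻¹' level i l ∩ level (j + 1) (l' + d * height j)) =
          if d = cuts j then 0 else width (j + 1) := by
      intro d hd
      rw [Finset.mem_Icc] at hd
      split_ifs with h
      · subst h
        have hdisj : Disjoint (shift^[height j] ⁻¹' level i l)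
            (level (j + 1) (l' + cuts j * height j)) :=
          Set.disjoint_left.2 fun x hx hx' => hout x hx' hx
        rw [hdisj.inter_eq, measureReal_empty]
      · rw [Set.inter_eq_self_of_subset_right, volume_real_level]
        intro x hx
        exact hss (level_copy_subset hl' (by omega) (by omega) (hmem d hd.2 x hx))
    rw [Finset.sum_congr rfl hterm, Set.inter_eq_self_of_subset_right hss, volume_real_level,
      ← cuts_mul_width j]
    have h2 := two_le_cuts j
    have h3 : ∀ d, (if d = cuts j then 0 else width (j + 1)) =
        width (j + 1) - if d = cuts j then width (j + 1) else 0 := fun d => by split_ifs <;> ring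
    simp_rw [h3]
    rw [Finset.sum_sub_distrib, Finset.sum_const, Finset.sum_ite_eq', if_pos
      (Finset.mem_Icc.2 ⟨by omega, le_rfl⟩), Nat.card_Icc, nsmul_eq_mul, Nat.add_sub_cancel]
    have := cuts_pos j
    field_simp
  · push Not at hsub
    rw [Disjoint.inter_eq (Set.disjoint_left.2 hsub), measureReal_empty, mul_zero]
    refine Finset.sum_eq_zero fun d hd => ?_
    rw [Finset.mem_Icc] at hd
    rw [Disjoint.inter_eq, measureReal_empty]
    refine Set.disjoint_left.2 fun x hx hx' => ?_
    rcases hd.2.lt_or_eq with h | rfl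
    · exact hsub _ hx (level_copy_subset hl' (by omega) h (hmem d hd.2 x hx'))
    · exact hout x hx' hx

theorem weakPowerLimit_shift {q : ℕ → ℕ} (hq : Tendsto q atTop atTop) {c : ℝ}
    (hc : Tendsto (fun i => 1 - (cuts (q i) : ℝ)⁻¹) atTop (𝓝 c)) :
    WeakPowerLimit (koopman measurePreserving_shift) (fun i => height (q i)) c := by
  obtain ⟨S, hS, hcov⟩ := exists_levels_cover
  refine weakPowerLimit_of_piSystem _ generateFrom_levels isPiSystem_levels S hS hcov
    (fun A hA => volume_levels_ne_top hA) ?_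
  rintro _ ⟨i, l, -, hl, rfl⟩ _ ⟨i', l', -, hl', rfl⟩
  -- For a fixed pair of levels the proportion is exact once the stage is past both; only the factor
  -- still varies.
  refine (hc.mul_const _).congr' ?_
  filter_upwards [hq.eventually_ge_atTop i, hq.eventually_ge_atTop i'] with k hk hk'
  rw [Set.inter_comm (level i l), Set.inter_comm (level i l)]
  exact (measureReal_inter_level_descend hk
    ((measurePreserving_shift.iterate _).measurable (measurableSet_level i' l'))
    (measurableSet_level i' l') (fun n hn => measureReal_shift_preimage hk' hl' hn) l hl).symm

theorem le_height (j : ℕ) : j ≤ height j := by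
  induction j with
  | zero => exact Nat.zero_le _
  | succ j ih =>
    have h1 := two_le_cuts j
    have h2 := height_pos j
    rw [height]
    nlinarith

theorem hasMixedLimits_shift : HasMixedLimits measurePreserving_shift := by
  have heven : Tendsto (fun i : ℕ => 2 * i) atTop atTop := tendsto_id.const_mul_atTop' two_pos
  have hodd : Tendsto (fun i : ℕ => 2 * i + 1) atTop atTop := 
    (tendsto_add_atTop_nat 1).comp heven
  have hheight : Tendsto height atTop atTop := tendsto_atTop_mono le_height tendsto_id
  -- Even stages give `1 - 1 / 2`; odd stages have `2 * i + 2` cuts, so the factor tends to `1`.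
  refine ⟨1 / 2, fun i => height (2 * i), fun i => height (2 * i + 1), by norm_num, by norm_num,
    hheight.comp heven, hheight.comp hodd, weakPowerLimit_shift heven ?_,
    (weakPowerLimit_shift hodd ?_).strongPowerLimitOne (koopman_norm _)⟩
  · have : ∀ i, (1 : ℝ) - (cuts (2 * i) : ℝ)⁻¹ = 1 / 2 := fun i => by
      rw [cuts, if_pos (even_two_mul i)]; norm_num
    simp_rw [this]
    exact tendsto_const_nhds
  · have h1 : Tendsto (fun i => cuts (2 * i + 1)) atTop atTop := by
      refine tendsto_atTop_mono (fun i => ?_) tendsto_id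
      rw [cuts, if_neg (by simp)]
      simp only [id]; omega
    simpa using (tendsto_inv_atTop_zero.comp
      ((tendsto_natCast_atTop_atTop (R := ℝ)).comp h1)).const_sub 1

/-- Levels of one tower are translates under the map, and slicing relates successive towers, so an
invariant set occupies the same fraction `α` of every level. Its indicator then equals `α` almost
everywhere, which forces a null or conull set. -/
theorem ergodic_shift : Ergodic shiftEquiv volume := by
  refine ⟨measurePreserving_shift, ⟨fun s hs hinv => ?_⟩⟩
  have hinv' : shift ⁻¹' s = s := hinv
  have hconst : ∀ j l, l < height j →
      volume.real (s ∩ level j l) = volume.real (s ∩ level j 0) := by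
    intro j l hl
    induction l with
    | zero => rfl
    | succ l ih =>
      rw [← ih (by omega)]
      have := measurePreserving_shift.measure_preimage
        (hs.inter (measurableSet_level j (l + 1))).nullMeasurableSet
      change volume (shift ⁻¹' _) = _ at this
      rw [Set.preimage_inter, hinv', shift_preimage_level hl] at this
      rw [Measure.real, Measure.real, this]
  set α := volume.real (s ∩ level 0 0)
  have hα : ∀ j, volume.real (s ∩ level j 0) = α * width j := by
    intro j
    induction j with
    | zero => simp [α, width]
    | succ j ih =>
      have h1 := measureReal_inter_level (height_pos j) hs
      rw [Finset.sum_congr rfl fun d hd => hconst (j + 1) _ (column_lt (height_pos j)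
        (by rw [Finset.mem_Icc] at hd; omega)), Finset.sum_const, Nat.card_Icc, nsmul_eq_mul,
        Nat.add_sub_cancel, ih, ← cuts_mul_width j] at h1
      exact mul_left_cancel₀ (cuts_pos j).ne' (by rw [← h1]; ring)
  obtain ⟨S, hS, hcov⟩ := exists_levels_cover
  have hzero := ae_eq_zero_of_setIntegral_piSystem (μ := volume) generateFrom_levels
    isPiSystem_levels S hS hcov (h := fun x => s.indicator (fun _ => (1 : ℂ)) x - (α : ℂ))
    (fun A hA => ?_) (fun A hA => ?_)
  · rw [eventuallyConst_set]
    by_cases h1 : α = 1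
    · left
      filter_upwards [hzero] with x hx
      by_contra hxs
      simp [hxs, h1] at hx
    · right
      filter_upwards [hzero] with x hx hxs
      simp only [hxs, Set.indicator_of_mem, Pi.zero_apply, sub_eq_zero] at hx
      exact h1 (by exact_mod_cast hx.symm)
  · have hfin : IsFiniteMeasure (volume.restrict A) :=
      isFiniteMeasure_restrict.2 (volume_levels_ne_top hA)
    exact ((integrable_const (1 : ℂ)).indicator hs).sub (integrable_const _)
  · have hfin : IsFiniteMeasure (volume.restrict A) :=
      isFiniteMeasure_restrict.2 (volume_levels_ne_top hA)
    rw [integral_sub ((integrable_const (1 : ℂ)).indicator hs) (integrable_const _),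
      integral_indicator hs, integral_const, integral_const, measureReal_restrict_apply .univ,
      Set.univ_inter, measureReal_restrict_apply .univ, Set.univ_inter]
    obtain ⟨j, l, -, hl, rfl⟩ := hA
    rw [measureReal_restrict_apply hs, hconst j l hl, hα, volume_real_level]
    simp [mul_comm]

end RankOne

end

theorem mainTheorem4 :
    (∃ (T : ℝ ≃ᵐ ℝ) (hT : MeasurePreserving T volume volume),
      Ergodic T volume ∧ HasMixedLimits hT) ∧
    (∀ (T : ℝ ≃ᵐ ℝ) (hT : MeasurePreserving T volume volume), HasMixedLimits hT →
      ∀ (p : ℕ) (hp : 1 < p),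
        SpectrumSingularToPowers (cyclicExtension_measurePreserving hT p hp) ∧
        NoIntertwiningWithPowers (cyclicExtension_measurePreserving hT p hp)) :=
  ⟨⟨RankOne.shiftEquiv, RankOne.measurePreserving_shift, RankOne.ergodic_shift,
    RankOne.hasMixedLimits_shift⟩, cyclicExtension_properties⟩
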